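/- For $\alpha\in\mathbb R$ and $x>0$ let $K_\alpha(x)=\int_0^\infty e^{-x\cosh t}\cosh(\alpha t)\,dt$ be the modified Bessel function of the second kind. Fix any $\eta>0$ and put $$F(\alpha)=\int_0^\eta \frac{x\,K_{\alpha-1}(x)}{K_\alpha(x)}\,dx ,\qquad \alpha\in\mathbb R ,$$ where the integral converges absolutely for every real $\alpha$. Then $F$ is real analytic on $(-1,1)\setminus\{0\}$, and it is $C^\infty$ on $(-1,1)$, in particular at $0$, but it is not analytic at $0$. Its Taylor coefficients $c_n=F^{(n)}(0)/n!$ at $0$ satisfy $c_1=-\eta$, $c_{2n+1}=0$ for every $n\ge 1$, and $$c_{2n}\sim 4e^{-\gamma}(-1)^{n+1}\frac{(2n-1)!}{\pi^{2n}}\qquad (n\to\infty),$$ where $\gamma$ is the Euler–Mascheroni constant and $\sim$ means that the ratio of the two sides tends to $1$. Consequently the Taylor series $\sum_{n\ge 0} c_n\alpha^n$ of $F$ at $0$ has radius of convergence zero. -/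

import Mathlib

open MeasureTheory Set Filter Asymptotics
open scoped ContDiff Nat

namespace McCoyWu

/-- The modified Bessel function of the second kind `K_α(x)`, for real index `α` and `x > 0`:
`K_α(x) = ∫_0^∞ exp(-x cosh t) cosh(α t) dt`. -/
noncomputable def besselK (α x : ℝ) : ℝ :=
  ∫ t in Ioi (0 : ℝ), Real.exp (-x * Real.cosh t) * Real.cosh (α * t)

/-- The integrand `x K_{α-1}(x) / K_α(x)`. -/
noncomputable def integrand (α x : ℝ) : ℝ :=
  x * besselK (α - 1) x / besselK α x

/-- The function `α ↦ ∫_{(0,η)} x K_{α-1}(x) / K_α(x) dx`. -/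
noncomputable def F (η α : ℝ) : ℝ :=
  ∫ x in Ioo (0 : ℝ) η, integrand α x

/-- The `n`-th Taylor coefficient at the origin, `f⁽ⁿ⁾(0) / n!`. -/
noncomputable def taylorCoeff (f : ℝ → ℝ) (n : ℕ) : ℝ :=
  iteratedDeriv n f 0 / (n ! : ℝ)

end McCoyWu

/-!
With `y = x / 2` the substitution `u = y e^t` turns the Bessel function into a Mellin transform,
`2 K_s(x) = y^(-s) M(s, y)` with `M(s, y) = ∫_0^∞ u^(s-1) e^(-u - y²/u) du` (`mellinK`). This is entire
in `s` for `y > 0`, tends to `Γ(s)` as `y → 0` if `Re s > 1/2`, is reflected by `u ↦ y² / u`, and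
satisfies the three-term recurrence of the Bessel functions. By the recurrence, the integrand plus
`α` is `(M(α+1, y) + y² M(α-1, y)) / M(α, y)` (`ratioK`), which is even in `α`. Hence `F(α) + η α` is
even, which settles the odd coefficients.

Regularity. For `s = a + i b` the difference `M(s, y) - M(a, y)` is at most `|b|` times a
logarithmic moment of `M` (`norm_mellinK_sub_le`). Near a fixed `a > 0` that moment is bounded
uniformly in `y`, so `ratioK` is holomorphic and bounded on a disc that does not depend on `y`, and
`F` is analytic there. Near `a = 0` the moment is of order `1 + |log y|` relative to `M(a, y)`, so
`ratioK` is bounded only on a strip of height `r / (1 + |log y|)`. Cauchy's estimates on this strip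
cost powers of `1 + |log y|`, which are integrable: `F` is smooth at `0`, and its Taylor
coefficients are integrals of those of `ratioK`.

Asymptotics. Let `L = log (2 / x) - γ`, and let `A` and `B` be the even and the odd part of
`e^(γ s) M(1 + s, y)`. Then `ratioK` at `s` is the quotient of `s (A cosh (s L) + B sinh (s L))` by
`A sinh (s L) + B cosh (s L)`. As `e^(γ s) Γ(1 + s)` has no linear term, `B` is of third order in `s`
up to an exponentially small error, and `ratioK` is close to `s coth (s L)`: on the circle of radius
`(1 - 1/n) π / L` the difference is `O(1 / (n L))` as long as `L ≥ δ n`. The coefficient of `s^(2n)`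
in `s coth (s L)` is `L^(2n-1)` times that of `z coth z`, which is asymptotic to
`2 (-1)^(n+1) / π^(2n)` because of the poles at `± i π`. Since `dx = - 2 e^(-γ) e^(-L) dL`, the
integral `∫ L^(2n-1) dx` is asymptotic to `2 e^(-γ) (2n-1)!`. For `L < δ n` the crude strip bound
makes the contribution negligible once `δ` is small. The factorial growth of the coefficients
forces the radius of convergence to be zero, and therefore `F` is not analytic at `0`.
-/

namespace McCoyWu

open Topology

local notation "γ" => Real.eulerMascheroniConstant

/-! ### The Mellin transform of the Bessel functions -/

/-- The weight `u ↦ exp (-u - y² / u)` on `(0, ∞)`. -/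
noncomputable def weightK (y u : ℝ) : ℝ := Real.exp (-u - y ^ 2 / u)

/-- The Mellin transform `∫_0^∞ u^(s-1) exp (-u - y² / u) du` at a complex point `s`;
for `y > 0` it is an entire function of `s`, equal to `2 y^s K_s(2 y)`. -/
noncomputable def mellinK (s : ℂ) (y : ℝ) : ℂ :=
  ∫ u in Ioi (0 : ℝ), (u : ℂ) ^ (s - 1) * (weightK y u : ℂ)

/-- The Mellin transform `mellinK` at a real point, as a real number. -/
noncomputable def mellinR (a y : ℝ) : ℝ :=
  ∫ u in Ioi (0 : ℝ), u ^ (a - 1) * weightK y u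

theorem weightK_pos (y u : ℝ) : 0 < weightK y u := Real.exp_pos _

theorem weightK_le_exp {y u : ℝ} (hu : 0 < u) : weightK y u ≤ Real.exp (-u) := by
  unfold weightK
  gcongr
  have : 0 ≤ y ^ 2 / u := by positivity
  linarith

theorem weightK_le_pow {y u : ℝ} (hy : 0 < y) (hu : 0 < u) (k : ℕ) :
    weightK y u ≤ (k ! : ℝ) / (y ^ 2) ^ k * u ^ k := by
  have hw : 0 < y ^ 2 / u := by positivity
  have h := Real.pow_div_factorial_le_exp (y ^ 2 / u) hw.le k
  have h1 : weightK y u ≤ Real.exp (-(y ^ 2 / u)) := by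
    unfold weightK; gcongr; linarith
  have h2 : Real.exp (-(y ^ 2 / u)) ≤ ((y ^ 2 / u) ^ k / (k ! : ℝ))⁻¹ := by
    rw [Real.exp_neg]
    gcongr
  refine h1.trans (h2.trans (le_of_eq ?_))
  rw [div_pow]
  field_simp

theorem continuousOn_weightK (y : ℝ) : ContinuousOn (weightK y) (Ioi 0) := by
  unfold weightK
  refine Real.continuous_exp.comp_continuousOn ?_
  refine continuousOn_id.neg.sub (continuousOn_const.div continuousOn_id ?_)
  intro u hu
  exact (ne_of_gt hu)

theorem weightK_locallyIntegrable (y : ℝ) :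
    LocallyIntegrableOn (fun u => (weightK y u : ℂ)) (Ioi 0) := by
  refine ContinuousOn.locallyIntegrableOn ?_ measurableSet_Ioi
  exact Complex.continuous_ofReal.comp_continuousOn (continuousOn_weightK y)

theorem weightK_isBigO_top (y : ℝ) :
    (fun u => (weightK y u : ℂ)) =O[atTop] fun t => Real.exp (-1 * t) := by
  refine IsBigO.of_bound 1 ?_
  filter_upwards [eventually_gt_atTop 0] with u hu
  rw [Complex.norm_real, Real.norm_of_nonneg (weightK_pos y u).le, Real.norm_of_nonneg
    (Real.exp_pos _).le, one_mul, neg_one_mul]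
  exact weightK_le_exp hu

theorem weightK_isBigO_zero {y : ℝ} (hy : 0 < y) (k : ℕ) :
    (fun u => (weightK y u : ℂ)) =O[𝓝[>] 0] fun t : ℝ => t ^ (-(-(k : ℝ))) := by
  refine IsBigO.of_bound ((k ! : ℝ) / (y ^ 2) ^ k) ?_
  filter_upwards [self_mem_nhdsWithin] with u hu
  have hu : 0 < u := hu
  rw [Complex.norm_real, Real.norm_of_nonneg (weightK_pos y u).le, neg_neg, Real.rpow_natCast,
    Real.norm_of_nonneg (by positivity)]
  exact weightK_le_pow hy hu k

theorem mellinConvergent_weightK {y : ℝ} (hy : 0 < y) (s : ℂ) :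
    MellinConvergent (fun u => (weightK y u : ℂ)) s := by
  obtain ⟨k, hk⟩ := exists_nat_gt (-s.re)
  exact mellinConvergent_of_isBigO_rpow_exp one_pos (weightK_locallyIntegrable y)
    (weightK_isBigO_top y) (weightK_isBigO_zero hy k) (by linarith)

theorem integrableOn_mellinK {y : ℝ} (hy : 0 < y) (s : ℂ) :
    IntegrableOn (fun u : ℝ => (u : ℂ) ^ (s - 1) * (weightK y u : ℂ)) (Ioi 0) := by
  simpa [MellinConvergent] using mellinConvergent_weightK hy s

theorem mellinK_eq_mellin (s : ℂ) (y : ℝ) : mellinK s y = mellin (fun u => (weightK y u : ℂ)) s := by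
  simp [mellinK, mellin]

theorem differentiable_mellinK {y : ℝ} (hy : 0 < y) : Differentiable ℂ (fun s => mellinK s y) := by
  intro s
  obtain ⟨k, hk⟩ := exists_nat_gt (-s.re)
  have h := mellin_differentiableAt_of_isBigO_rpow_exp (s := s) one_pos (weightK_locallyIntegrable y)
    (weightK_isBigO_top y) (weightK_isBigO_zero hy k) (by linarith)
  exact h.congr_of_eventuallyEq (Eventually.of_forall fun s => mellinK_eq_mellin s y)

theorem ofReal_integrand {u : ℝ} (hu : 0 < u) (a y : ℝ) :
    (u : ℂ) ^ ((a : ℂ) - 1) * (weightK y u : ℂ) = ((u ^ (a - 1) * weightK y u : ℝ) : ℂ) := by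
  rw [Complex.ofReal_mul, Complex.ofReal_cpow hu.le]
  push_cast
  rfl

theorem norm_mellinK_integrand {u : ℝ} (hu : 0 < u) (s : ℂ) (y : ℝ) :
    ‖(u : ℂ) ^ (s - 1) * (weightK y u : ℂ)‖ = u ^ (s.re - 1) * weightK y u := by
  rw [norm_mul, Complex.norm_cpow_eq_rpow_re_of_pos hu, Complex.norm_real,
    Real.norm_of_nonneg (weightK_pos y u).le]
  simp

theorem mellinK_ofReal (a y : ℝ) : mellinK (a : ℂ) y = (mellinR a y : ℂ) := by
  rw [mellinK, mellinR, ← integral_complex_ofReal]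
  exact setIntegral_congr_fun measurableSet_Ioi fun u hu => ofReal_integrand hu a y

theorem integrableOn_mellinR {y : ℝ} (hy : 0 < y) (a : ℝ) :
    IntegrableOn (fun u : ℝ => u ^ (a - 1) * weightK y u) (Ioi 0) := by
  refine IntegrableOn.congr_fun (integrableOn_mellinK hy (a : ℂ)).norm (fun u hu => ?_)
    measurableSet_Ioi
  simp only [norm_mellinK_integrand (show 0 < u from hu), Complex.ofReal_re]

theorem norm_mellinK_le (s : ℂ) (y : ℝ) : ‖mellinK s y‖ ≤ mellinR s.re y := by
  refine (norm_integral_le_integral_norm _).trans (le_of_eq ?_)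
  exact setIntegral_congr_fun measurableSet_Ioi fun u hu => norm_mellinK_integrand hu s y

theorem mellinR_pos {y : ℝ} (hy : 0 < y) (a : ℝ) : 0 < mellinR a y := by
  rw [mellinR, setIntegral_pos_iff_support_of_nonneg_ae]
  · have : (Function.support fun u : ℝ => u ^ (a - 1) * weightK y u) ∩ Ioi 0 = Ioi 0 := by
      refine inter_eq_right.2 fun u hu => ?_
      exact (mul_pos (Real.rpow_pos_of_pos hu _) (weightK_pos y u)).ne'
    rw [this]
    simp
  · filter_upwards [self_mem_ae_restrict measurableSet_Ioi] with u hu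
    exact (mul_pos (Real.rpow_pos_of_pos hu _) (weightK_pos y u)).le
  · exact integrableOn_mellinR hy a

/-- The reflection `s ↦ -s`, from the substitution `u ↦ y² / u`. -/
theorem mellinK_neg {y : ℝ} (hy : 0 < y) (s : ℂ) :
    mellinK (-s) y = ((y ^ 2 : ℝ) : ℂ) ^ (-s) * mellinK s y := by
  have hy2 : 0 < y ^ 2 := by positivity
  have h1 := mellin_comp_inv (fun u => (weightK y u : ℂ)) s
  have h2 := mellin_comp_mul_left (fun u => (weightK y u⁻¹ : ℂ)) s (a := (y ^ 2)⁻¹) (by positivity)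
  have h3 : mellin (fun t => (weightK y ((y ^ 2)⁻¹ * t)⁻¹ : ℂ)) s
      = mellin (fun u => (weightK y u : ℂ)) s := by
    refine setIntegral_congr_fun measurableSet_Ioi fun u hu => ?_
    have hu : 0 < u := hu
    have : weightK y ((y ^ 2)⁻¹ * u)⁻¹ = weightK y u := by
      unfold weightK
      congr 1
      field_simp
      ring
    simp only [this]
  rw [mellinK_eq_mellin, mellinK_eq_mellin, ← h1, ← h3, h2, smul_eq_mul, ← mul_assoc]
  rw [Complex.ofReal_inv, Complex.inv_cpow, Complex.cpow_neg, inv_inv, inv_mul_cancel₀, one_mul]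
  · simp [Complex.cpow_eq_zero_iff, hy.ne']
  · rw [Complex.arg_ofReal_of_nonneg hy2.le]; exact Real.pi_pos.ne

theorem hasDerivAt_weightK {y u : ℝ} (hu : 0 < u) :
    HasDerivAt (fun u => weightK y u) (weightK y u * (-1 + y ^ 2 / u ^ 2)) u := by
  unfold weightK
  refine HasDerivAt.exp ?_
  have h := ((hasDerivAt_id u).neg).sub ((hasDerivAt_const u (y ^ 2)).div (hasDerivAt_id u) hu.ne')
  refine h.congr_deriv ?_
  have h0 := hu.ne'
  simp only [id_eq]
  field_simp
  ring

/-- The three-term recurrence of the Bessel functions, from integration by parts. -/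
theorem mellinK_recurrence {y : ℝ} (hy : 0 < y) (s : ℂ) :
    mellinK (s + 1) y - (y : ℂ) ^ 2 * mellinK (s - 1) y = s * mellinK s y := by
  have hsplit : ∀ u ∈ Ioi (0 : ℝ), (u : ℂ) ^ s * ((weightK y u * (-1 + y ^ 2 / u ^ 2) : ℝ) : ℂ)
      = (y : ℂ) ^ 2 * ((u : ℂ) ^ ((s - 1) - 1) * (weightK y u : ℂ))
        - (u : ℂ) ^ ((s + 1) - 1) * (weightK y u : ℂ) := by
    intro u hu
    have hu0 : (u : ℂ) ≠ 0 := by exact_mod_cast (ne_of_gt hu)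
    have e1 : (u : ℂ) ^ ((s - 1) - 1) = (u : ℂ) ^ s / (u : ℂ) ^ 2 := by
      rw [sub_sub, Complex.cpow_sub _ _ hu0, one_add_one_eq_two]
      norm_cast
    rw [e1, add_sub_cancel_right]
    push_cast
    field_simp
    ring
  have hint : IntegrableOn (fun u : ℝ => (u : ℂ) ^ s *
      ((weightK y u * (-1 + y ^ 2 / u ^ 2) : ℝ) : ℂ)) (Ioi 0) := by
    refine IntegrableOn.congr_fun ?_ (fun u hu => (hsplit u hu).symm) measurableSet_Ioi
    exact ((integrableOn_mellinK hy (s - 1)).const_mul _).sub (integrableOn_mellinK hy (s + 1))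
  have hint2 : IntegrableOn (fun u : ℝ => (s * (u : ℂ) ^ (s - 1)) * (weightK y u : ℂ)) (Ioi 0) := by
    simp_rw [mul_assoc]
    exact (integrableOn_mellinK hy s).const_mul s
  have hlim : ∀ l : Filter ℝ, (∀ᶠ u in l, 0 < u) →
      Tendsto (fun u : ℝ => u ^ s.re * weightK y u) l (𝓝 0) →
      Tendsto ((fun u : ℝ => (u : ℂ) ^ s) * fun u : ℝ => (weightK y u : ℂ)) l (𝓝 0) := by
    intro l hl h
    rw [tendsto_zero_iff_norm_tendsto_zero]
    refine h.congr' ?_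
    filter_upwards [hl] with u hu
    rw [Pi.mul_apply, norm_mul, Complex.norm_cpow_eq_rpow_re_of_pos hu, Complex.norm_real,
      Real.norm_of_nonneg (weightK_pos y u).le]
  have h0 : Tendsto ((fun u : ℝ => (u : ℂ) ^ s) * fun u : ℝ => (weightK y u : ℂ)) (𝓝[>] 0) (𝓝 0) := by
    refine hlim _ self_mem_nhdsWithin ?_
    obtain ⟨k, hk⟩ := exists_nat_gt (-s.re)
    have hc : Tendsto (fun u : ℝ => (k ! : ℝ) / (y ^ 2) ^ k * u ^ (s.re + k)) (𝓝[>] 0) (𝓝 0) := by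
      have : Tendsto (fun u : ℝ => u ^ (s.re + k)) (𝓝[>] 0) (𝓝 0) := by
        have h := (Real.continuousAt_rpow_const 0 (s.re + k) (Or.inr (by linarith))).tendsto
        rw [Real.zero_rpow (by linarith)] at h
        exact h.mono_left nhdsWithin_le_nhds
      simpa using this.const_mul ((k ! : ℝ) / (y ^ 2) ^ k)
    refine squeeze_zero' ?_ ?_ hc
    · filter_upwards [self_mem_nhdsWithin] with u hu
      exact (mul_pos (Real.rpow_pos_of_pos hu _) (weightK_pos y u)).le
    · filter_upwards [self_mem_nhdsWithin] with u hu
      have hu : 0 < u := hu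
      rw [Real.rpow_add hu, Real.rpow_natCast]
      have := mul_le_mul_of_nonneg_left (weightK_le_pow hy hu k) (Real.rpow_pos_of_pos hu s.re).le
      linarith
  have h1 : Tendsto ((fun u : ℝ => (u : ℂ) ^ s) * fun u : ℝ => (weightK y u : ℂ)) atTop (𝓝 0) := by
    refine hlim _ (eventually_gt_atTop 0) ?_
    refine squeeze_zero' ?_ ?_ (tendsto_rpow_mul_exp_neg_mul_atTop_nhds_zero s.re 1 one_pos)
    · filter_upwards [eventually_gt_atTop 0] with u hu
      exact (mul_pos (Real.rpow_pos_of_pos hu _) (weightK_pos y u)).le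
    · filter_upwards [eventually_gt_atTop 0] with u hu
      rw [neg_one_mul]
      exact mul_le_mul_of_nonneg_left (weightK_le_exp hu) (Real.rpow_pos_of_pos hu s.re).le
  have key := integral_Ioi_mul_deriv_eq_deriv_mul (u := fun u : ℝ => (u : ℂ) ^ s)
    (v := fun u : ℝ => (weightK y u : ℂ)) (u' := fun u : ℝ => s * (u : ℂ) ^ (s - 1))
    (v' := fun u : ℝ => ((weightK y u * (-1 + y ^ 2 / u ^ 2) : ℝ) : ℂ))
    (fun u hu => ?_) (fun u hu => (hasDerivAt_weightK hu).ofReal_comp) hint hint2 h0 h1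
  · rw [setIntegral_congr_fun measurableSet_Ioi hsplit, integral_sub
      ((integrableOn_mellinK hy (s - 1)).const_mul _) (integrableOn_mellinK hy (s + 1)),
      integral_const_mul] at key
    simp_rw [mul_assoc] at key
    rw [integral_const_mul] at key
    simp only [mellinK]
    linear_combination -key
  · have := (hasDerivAt_id (u : ℂ)).cpow_const (c := s) (Or.inl (show 0 < (u : ℂ).re from hu))
    simpa using this.comp_ofReal

/-- The substitution `u = y e^t` in the Mellin transform. -/
theorem mellinR_eq_integral_exp {y : ℝ} (hy : 0 < y) (a : ℝ) :
    Integrable (fun t : ℝ => Real.exp (-(2 * y) * Real.cosh t) * Real.exp (a * t)) ∧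
    mellinR a y = y ^ a * ∫ t : ℝ, Real.exp (-(2 * y) * Real.cosh t) * Real.exp (a * t) := by
  have himg : (fun t : ℝ => y * Real.exp t) '' univ = Ioi 0 := by
    ext u
    simp only [image_univ, mem_range, mem_Ioi]
    constructor
    · rintro ⟨t, rfl⟩; positivity
    · intro hu
      refine ⟨Real.log (u / y), ?_⟩
      rw [Real.exp_log (by positivity)]
      field_simp
  have hder : ∀ t ∈ (univ : Set ℝ), HasDerivWithinAt (fun t : ℝ => y * Real.exp t)
      (y * Real.exp t) univ t := fun t _ => ((Real.hasDerivAt_exp t).const_mul y).hasDerivWithinAt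
  have hinj : InjOn (fun t : ℝ => y * Real.exp t) univ := by
    intro s _ t _ h
    exact Real.exp_injective (mul_left_cancel₀ hy.ne' h)
  have hfun : ∀ t : ℝ, |y * Real.exp t| • ((y * Real.exp t) ^ (a - 1) * weightK y (y * Real.exp t))
      = y ^ a * (Real.exp (-(2 * y) * Real.cosh t) * Real.exp (a * t)) := by
    intro t
    have hp : 0 < y * Real.exp t := by positivity
    rw [abs_of_pos hp, smul_eq_mul, ← mul_assoc]
    have e1 : y * Real.exp t * (y * Real.exp t) ^ (a - 1) = y ^ a * Real.exp (a * t) := by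
      rw [Real.rpow_sub_one hp.ne', mul_div_cancel₀ _ hp.ne',
        Real.mul_rpow hy.le (Real.exp_pos t).le, ← Real.exp_mul, mul_comm t]
    have e2 : weightK y (y * Real.exp t) = Real.exp (-(2 * y) * Real.cosh t) := by
      unfold weightK
      congr 1
      rw [Real.cosh_eq, Real.exp_neg]
      field_simp
      ring
    rw [e1, e2]; ring
  constructor
  · have h := (integrableOn_image_iff_integrableOn_abs_deriv_smul MeasurableSet.univ hder hinj
      (fun u : ℝ => u ^ (a - 1) * weightK y u)).1 (by rw [himg]; exact integrableOn_mellinR hy a)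
    simp_rw [hfun] at h
    rw [integrableOn_univ] at h
    have hya : y ^ a ≠ 0 := (Real.rpow_pos_of_pos hy a).ne'
    refine (h.const_mul (y ^ a)⁻¹).congr (Eventually.of_forall fun t => ?_)
    simp only
    rw [inv_mul_cancel_left₀ hya]
  · rw [mellinR, ← himg, integral_image_eq_integral_abs_deriv_smul MeasurableSet.univ hder hinj]
    simp_rw [hfun]
    rw [integral_const_mul, setIntegral_univ]

theorem besselK_eq_mellinR {y : ℝ} (hy : 0 < y) (a : ℝ) :
    besselK a (2 * y) = y ^ (-a) * mellinR a y / 2 := by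
  obtain ⟨hint, heq⟩ := mellinR_eq_integral_exp hy a
  set h : ℝ → ℝ := fun t => Real.exp (-(2 * y) * Real.cosh t) * Real.exp (a * t) with hh
  have h1 : ∫ t : ℝ, h t = ∫ t in Ioi (0 : ℝ), (h (-t) + h t) := by
    rw [integral_add (hint.comp_neg.integrableOn) hint.integrableOn, integral_comp_neg_Ioi, neg_zero,
      ← setIntegral_univ, ← Set.Iic_union_Ioi (a := (0 : ℝ)),
      setIntegral_union (Iic_disjoint_Ioi le_rfl) measurableSet_Ioi hint.integrableOn
        hint.integrableOn]
  have h2 : ∫ t in Ioi (0 : ℝ), (h (-t) + h t) = 2 * besselK a (2 * y) := by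
    rw [besselK, ← integral_const_mul]
    refine setIntegral_congr_fun measurableSet_Ioi fun t _ => ?_
    simp only [hh, Real.cosh_neg, Real.cosh_eq (a * t)]
    ring_nf
  rw [heq, h1, h2, ← mul_assoc, ← Real.rpow_add hy]
  simp

theorem integrand_eq_mellinR {y : ℝ} (hy : 0 < y) (a : ℝ) :
    integrand a (2 * y) = 2 * y ^ 2 * mellinR (a - 1) y / mellinR a y := by
  rw [integrand, besselK_eq_mellinR hy, besselK_eq_mellinR hy]
  have h1 : y ^ (-(a - 1)) = y * y ^ (-a) := by
    rw [neg_sub, sub_eq_add_neg, Real.rpow_add hy, Real.rpow_one]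
  have h2 : y ^ (-a) ≠ 0 := (Real.rpow_pos_of_pos hy _).ne'
  have h3 := (mellinR_pos hy a).ne'
  rw [h1]
  field_simp

/-! ### Bounds for the Mellin transform off the real axis -/

theorem measurable_mellinK (s : ℂ) : Measurable (mellinK s) := by
  refine StronglyMeasurable.measurable ?_
  refine StronglyMeasurable.integral_prod_right' (f := fun p : ℝ × ℝ =>
    (p.2 : ℂ) ^ (s - 1) * (weightK p.1 p.2 : ℂ)) ?_
  refine Measurable.stronglyMeasurable ?_
  unfold weightK
  fun_prop

theorem mellinR_neg {y : ℝ} (hy : 0 < y) (a : ℝ) : mellinR (-a) y = y ^ (-(2 * a)) * mellinR a y := by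
  have h := mellinK_neg hy (a : ℂ)
  rw [← Complex.ofReal_neg, mellinK_ofReal, mellinK_ofReal, ← Complex.ofReal_cpow (by positivity),
    ← Complex.ofReal_mul, Complex.ofReal_inj, ← Real.rpow_natCast, ← Real.rpow_mul hy.le] at h
  rw [h]
  congr 2
  push_cast
  ring

theorem rpow_le_add {u p a q : ℝ} (hu : 0 < u) (hpa : p ≤ a) (haq : a ≤ q) :
    u ^ a ≤ u ^ p + u ^ q := by
  rcases le_total u 1 with h | h
  · have := Real.rpow_le_rpow_of_exponent_ge hu h hpa
    have := Real.rpow_nonneg hu.le q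
    linarith
  · have := Real.rpow_le_rpow_of_exponent_le h haq
    have := Real.rpow_nonneg hu.le p
    linarith

theorem mellinR_le_add {y p a q : ℝ} (hy : 0 < y) (hpa : p ≤ a) (haq : a ≤ q) :
    mellinR a y ≤ mellinR p y + mellinR q y := by
  unfold mellinR
  rw [← integral_add (integrableOn_mellinR hy p) (integrableOn_mellinR hy q)]
  refine setIntegral_mono_on (integrableOn_mellinR hy a)
    ((integrableOn_mellinR hy p).add (integrableOn_mellinR hy q)) measurableSet_Ioi fun u hu => ?_
  rw [← add_mul]
  exact mul_le_mul_of_nonneg_right (rpow_le_add hu (by linarith) (by linarith)) (weightK_pos y u).le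

theorem mellinR_le_Gamma {y a : ℝ} (hy : 0 < y) (ha : 0 < a) : mellinR a y ≤ Real.Gamma a := by
  rw [Real.Gamma_eq_integral ha]
  refine setIntegral_mono_on (integrableOn_mellinR hy a) (Real.GammaIntegral_convergent ha)
    measurableSet_Ioi fun u hu => ?_
  rw [mul_comm]
  exact mul_le_mul_of_nonneg_right (weightK_le_exp hu) (Real.rpow_nonneg (le_of_lt hu) _)

theorem mellinR_le_Gamma_add_Gamma {y p a q : ℝ} (hy : 0 < y) (hp : 0 < p) (hpa : p ≤ a)
    (haq : a ≤ q) : mellinR a y ≤ Real.Gamma p + Real.Gamma q :=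
  (mellinR_le_add hy hpa haq).trans
    (add_le_add (mellinR_le_Gamma hy hp) (mellinR_le_Gamma hy (by linarith)))

/-- A lower bound for the Mellin transform that is uniform in the exponent and down to `y = 0`. -/
theorem le_mellinR {y Y a : ℝ} (hy : 0 < y) (hyY : y ≤ Y) (ha : 0 ≤ a) :
    Real.exp (-2 - Y ^ 2) / 2 ≤ mellinR a y := by
  have hsub : Icc (1 : ℝ) 2 ⊆ Ioi 0 := fun u hu => lt_of_lt_of_le one_pos hu.1
  have h1 : ∫ _ in Icc (1 : ℝ) 2, Real.exp (-2 - Y ^ 2) / 2 ≤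
      ∫ u in Icc (1 : ℝ) 2, u ^ (a - 1) * weightK y u := by
    refine setIntegral_mono_on (by simp) ((integrableOn_mellinR hy a).mono_set hsub)
      measurableSet_Icc fun u hu => ?_
    have hu0 : 0 < u := hsub hu
    have e1 : 1 / 2 ≤ u ^ (a - 1) := by
      calc (1 / 2 : ℝ) ≤ u⁻¹ := by
            rw [one_div]; exact inv_anti₀ hu0 hu.2
        _ = u ^ (-1 : ℝ) := (Real.rpow_neg_one u).symm
        _ ≤ u ^ (a - 1) := Real.rpow_le_rpow_of_exponent_le hu.1 (by linarith)
    have e2 : Real.exp (-2 - Y ^ 2) ≤ weightK y u := by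
      unfold weightK
      gcongr Real.exp ?_
      have : y ^ 2 / u ≤ Y ^ 2 := by
        calc y ^ 2 / u ≤ y ^ 2 := div_le_self (by positivity) hu.1
          _ ≤ Y ^ 2 := by gcongr
      linarith [hu.2]
    calc Real.exp (-2 - Y ^ 2) / 2 = 1 / 2 * Real.exp (-2 - Y ^ 2) := by ring
      _ ≤ _ := by gcongr
  have h2 : ∫ u in Icc (1 : ℝ) 2, u ^ (a - 1) * weightK y u ≤ mellinR a y := by
    refine setIntegral_mono_set (integrableOn_mellinR hy a) ?_ hsub.eventuallyLE
    filter_upwards [self_mem_ae_restrict measurableSet_Ioi] with u hu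
    exact (mul_pos (Real.rpow_pos_of_pos hu _) (weightK_pos y u)).le
  refine le_trans (le_of_eq ?_) (h1.trans h2)
  simp
  norm_num

/-- Moving vertically off the real axis changes the Mellin transform by at most the height times
a first logarithmic moment. -/
theorem norm_mellinK_sub_le {y : ℝ} (hy : 0 < y) (s : ℂ) {c₀ c₁ c₂ p q : ℝ}
    (hlog : ∀ u : ℝ, 0 < u → |Real.log u| ≤ c₀ + c₁ * u ^ p + c₂ * u ^ (-q)) :
    ‖mellinK s y - mellinR s.re y‖ ≤
      |s.im| * (c₀ * mellinR s.re y + c₁ * mellinR (s.re + p) y + c₂ * mellinR (s.re - q) y) := by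
  set a := s.re
  have i0 := (integrableOn_mellinR hy a).const_mul c₀
  have i1 := (integrableOn_mellinR hy (a + p)).const_mul c₁
  have i2 := (integrableOn_mellinR hy (a - q)).const_mul c₂
  have i01 : IntegrableOn (fun u : ℝ => c₀ * (u ^ (a - 1) * weightK y u) +
      c₁ * (u ^ (a + p - 1) * weightK y u)) (Ioi 0) := i0.add i1
  rw [← mellinK_ofReal, mellinK, mellinK, ← integral_sub (integrableOn_mellinK hy s) (integrableOn_mellinK hy a)]
  have hR : |s.im| * (c₀ * mellinR a y + c₁ * mellinR (a + p) y + c₂ * mellinR (a - q) y) =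
      ∫ u in Ioi (0 : ℝ), |s.im| * (c₀ * (u ^ (a - 1) * weightK y u) +
        c₁ * (u ^ (a + p - 1) * weightK y u) + c₂ * (u ^ (a - q - 1) * weightK y u)) := by
    rw [integral_const_mul, integral_add i01 i2, integral_add i0 i1, integral_const_mul,
      integral_const_mul, integral_const_mul]
    rfl
  rw [hR]
  refine norm_integral_le_of_norm_le ((i01.add i2).const_mul _) ?_
  filter_upwards [self_mem_ae_restrict measurableSet_Ioi] with u hu
  have hu : 0 < u := hu
  have hu0 : (u : ℂ) ≠ 0 := by exact_mod_cast hu.ne'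
  have e1 : (u : ℂ) ^ (s - 1) * (weightK y u : ℂ) - (u : ℂ) ^ ((a : ℂ) - 1) * (weightK y u : ℂ) =
      (u : ℂ) ^ ((a : ℂ) - 1) * (weightK y u : ℂ) *
        (Complex.exp (Complex.I * ((Real.log u * s.im : ℝ) : ℂ)) - 1) := by
    have : (u : ℂ) ^ (s - 1) = (u : ℂ) ^ ((a : ℂ) - 1) *
        Complex.exp (Complex.I * ((Real.log u * s.im : ℝ) : ℂ)) := by
      rw [Complex.cpow_def_of_ne_zero hu0, Complex.cpow_def_of_ne_zero hu0, ← Complex.exp_add]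
      congr 1
      rw [← Complex.ofReal_log hu.le]
      conv_lhs => rw [← Complex.re_add_im s]
      push_cast
      ring
    rw [this]; ring
  rw [e1, norm_mul, norm_mellinK_integrand hu, Complex.ofReal_re]
  have e2 := Real.norm_exp_I_mul_ofReal_sub_one_le (x := Real.log u * s.im)
  rw [Real.norm_eq_abs, abs_mul] at e2
  have hk := weightK_pos y u
  have hpow := Real.rpow_pos_of_pos hu (a - 1)
  have e3 : u ^ (a + p - 1) = u ^ (a - 1) * u ^ p := by
    rw [← Real.rpow_add hu]; ring_nf
  have e4 : u ^ (a - q - 1) = u ^ (a - 1) * u ^ (-q) := by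
    rw [← Real.rpow_add hu]; ring_nf
  rw [e3, e4]
  calc u ^ (a - 1) * weightK y u * _
      ≤ u ^ (a - 1) * weightK y u * ((c₀ + c₁ * u ^ p + c₂ * u ^ (-q)) * |s.im|) := by
        refine mul_le_mul_of_nonneg_left (e2.trans ?_) (by positivity)
        exact mul_le_mul_of_nonneg_right (hlog u hu) (abs_nonneg _)
    _ = _ := by ring

theorem one_sub_exp_neg_le_sqrt {w : ℝ} (hw : 0 ≤ w) : 1 - Real.exp (-w) ≤ w ^ (1 / 2 : ℝ) := by
  rcases le_total w 1 with h | h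
  · have h1 := Real.add_one_le_exp (-w)
    have h2 : w ≤ w ^ (1 / 2 : ℝ) := by
      rcases hw.eq_or_lt with rfl | hw
      · simp
      · conv_lhs => rw [← Real.rpow_one w]
        exact Real.rpow_le_rpow_of_exponent_ge hw h (by norm_num)
    linarith
  · have h1 := Real.exp_pos (-w)
    have h2 : 1 ≤ w ^ (1 / 2 : ℝ) := Real.one_le_rpow h (by norm_num)
    linarith

/-- As `y → 0` the Mellin transform tends to the Gamma function. -/
theorem norm_mellinK_sub_Gamma_le {y : ℝ} (hy : 0 < y) {s : ℂ} (hs : 1 / 2 < s.re) :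
    ‖mellinK s y - Complex.Gamma s‖ ≤ y * Real.Gamma (s.re - 1 / 2) := by
  have hs0 : 0 < s.re := by linarith
  have hs1 : 0 < s.re - 1 / 2 := by linarith
  rw [Complex.Gamma_eq_integral hs0, mellinK, Complex.GammaIntegral,
    ← integral_sub (integrableOn_mellinK hy s) (Complex.GammaIntegral_convergent hs0),
    Real.Gamma_eq_integral hs1, ← integral_const_mul]
  refine norm_integral_le_of_norm_le ((Real.GammaIntegral_convergent hs1).const_mul _) ?_
  filter_upwards [self_mem_ae_restrict measurableSet_Ioi] with u hu
  have hu : 0 < u := hu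
  have hw : 0 ≤ y ^ 2 / u := by positivity
  have e1 : (u : ℂ) ^ (s - 1) * (weightK y u : ℂ) - ((-u).exp : ℂ) * (u : ℂ) ^ (s - 1) =
      -((u : ℂ) ^ (s - 1) * ((Real.exp (-u) * (1 - Real.exp (-(y ^ 2 / u))) : ℝ) : ℂ)) := by
    have : weightK y u = Real.exp (-u) * Real.exp (-(y ^ 2 / u)) := by
      rw [weightK, ← Real.exp_add]; ring_nf
    rw [this]; push_cast; ring
  have h1 : 0 ≤ 1 - Real.exp (-(y ^ 2 / u)) := by
    have := Real.exp_le_one_iff.2 (neg_nonpos.2 hw)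
    linarith
  have e2 : (y ^ 2 / u) ^ (1 / 2 : ℝ) = y * u ^ (-(1 / 2) : ℝ) := by
    rw [Real.div_rpow (by positivity) hu.le, Real.rpow_neg hu.le, ← Real.sqrt_eq_rpow (y ^ 2),
      Real.sqrt_sq hy.le, div_eq_mul_inv]
  have e3 : u ^ (s.re - 1 / 2 - 1) = u ^ (s.re - 1) * u ^ (-(1 / 2) : ℝ) := by
    rw [← Real.rpow_add hu]; ring_nf
  rw [e1, norm_neg, norm_mul, Complex.norm_cpow_eq_rpow_re_of_pos hu, Complex.norm_real,
    Real.norm_of_nonneg (mul_nonneg (Real.exp_pos _).le h1), e3, Complex.sub_re, Complex.one_re]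
  have h2 := one_sub_exp_neg_le_sqrt hw
  rw [e2] at h2
  have hp := Real.rpow_pos_of_pos hu (s.re - 1)
  calc u ^ (s.re - 1) * (Real.exp (-u) * (1 - Real.exp (-(y ^ 2 / u))))
      ≤ u ^ (s.re - 1) * (Real.exp (-u) * (y * u ^ (-(1 / 2) : ℝ))) := by gcongr
    _ = _ := by ring

/-- The function `s ↦ x (K_{s+1}(x) + K_{s-1}(x)) / (2 K_s(x))` of complex `s`, at `x = 2 y`. It is even
in `s`, and equal to the integrand plus `s` at real `s` (`ratioK_ofReal`). -/
noncomputable def ratioK (y : ℝ) (s : ℂ) : ℂ :=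
  (mellinK (s + 1) y + (y : ℂ) ^ 2 * mellinK (s - 1) y) / mellinK s y

theorem mellinK_neg_eq_zero_iff {y : ℝ} (hy : 0 < y) (s : ℂ) : mellinK (-s) y = 0 ↔ mellinK s y = 0 := by
  rw [mellinK_neg hy, mul_eq_zero, Complex.cpow_eq_zero_iff]
  simp [hy.ne']

theorem ratioK_neg {y : ℝ} (hy : 0 < y) (s : ℂ) : ratioK y (-s) = ratioK y s := by
  have hy0 : (y : ℂ) ≠ 0 := by exact_mod_cast hy.ne'
  have hY : ((y ^ 2 : ℝ) : ℂ) ≠ 0 := by exact_mod_cast (pow_pos hy 2).ne'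
  have h1 : mellinK (-s + 1) y = (y : ℂ) ^ 2 * ((y ^ 2 : ℝ) : ℂ) ^ (-s) * mellinK (s - 1) y := by
    rw [show -s + 1 = -(s - 1) by ring, mellinK_neg hy, neg_sub, sub_eq_add_neg, Complex.cpow_add _ _ hY,
      Complex.cpow_one]
    push_cast; ring
  have h2 : (y : ℂ) ^ 2 * mellinK (-s - 1) y = ((y ^ 2 : ℝ) : ℂ) ^ (-s) * mellinK (s + 1) y := by
    rw [show -s - 1 = -(s + 1) by ring, mellinK_neg hy, neg_add, Complex.cpow_add _ _ hY,
      Complex.cpow_neg_one]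
    push_cast; field_simp
  have hc : ((y ^ 2 : ℝ) : ℂ) ^ (-s) ≠ 0 := by
    simp [Complex.cpow_eq_zero_iff, hy.ne']
  rw [ratioK, ratioK, h1, h2, mellinK_neg hy, show (y : ℂ) ^ 2 * ((y ^ 2 : ℝ) : ℂ) ^ (-s) * mellinK (s - 1) y +
    ((y ^ 2 : ℝ) : ℂ) ^ (-s) * mellinK (s + 1) y = ((y ^ 2 : ℝ) : ℂ) ^ (-s) *
      (mellinK (s + 1) y + (y : ℂ) ^ 2 * mellinK (s - 1) y) by ring, mul_div_mul_left _ _ hc]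

theorem ratioK_eq {y : ℝ} (hy : 0 < y) {s : ℂ} (hs : mellinK s y ≠ 0) :
    ratioK y s = 2 * mellinK (s + 1) y / mellinK s y - s := by
  have h := mellinK_recurrence hy s
  rw [ratioK]
  field_simp
  linear_combination -h

theorem ratioK_ofReal {y : ℝ} (hy : 0 < y) (a : ℝ) :
    ratioK y a = ((integrand a (2 * y) + a : ℝ) : ℂ) := by
  have h := mellinK_recurrence hy (a : ℂ)
  have h0 : (mellinR a y : ℂ) ≠ 0 := by exact_mod_cast (mellinR_pos hy a).ne'
  rw [integrand_eq_mellinR hy, ratioK]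
  rw [show (a : ℂ) + 1 = ((a + 1 : ℝ) : ℂ) by push_cast; rfl,
    show (a : ℂ) - 1 = ((a - 1 : ℝ) : ℂ) by push_cast; rfl, mellinK_ofReal, mellinK_ofReal, mellinK_ofReal] at *
  push_cast
  field_simp
  linear_combination h

theorem differentiableAt_ratioK {y : ℝ} (hy : 0 < y) {s : ℂ} (hs : mellinK s y ≠ 0) :
    DifferentiableAt ℂ (ratioK y) s := by
  have hd := differentiable_mellinK hy
  have h1 : Differentiable ℂ fun s => mellinK (s + 1) y := hd.comp (differentiable_id.add_const 1)
  have h2 : Differentiable ℂ fun s => mellinK (s - 1) y := hd.comp (differentiable_id.sub_const 1)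
  exact ((h1 s).add ((h2 s).const_mul _)).div (hd s) hs

theorem measurable_ratioK (s : ℂ) : Measurable fun y => ratioK y s := by
  unfold ratioK
  have h1 := measurable_mellinK s
  have h2 := measurable_mellinK (s + 1)
  have h3 := measurable_mellinK (s - 1)
  fun_prop

/-- If the Mellin transform loses at most half of its size off the real axis, then it does not
vanish and the extended integrand is bounded. -/
theorem ratioK_bound_of_sub_le {y Y : ℝ} (hy : 0 < y) (hyY : y ≤ Y) {s : ℂ} (ha : 0 ≤ s.re) {G : ℝ}
    (hG : mellinR (s.re + 1) y ≤ G) (h : ‖mellinK s y - mellinR s.re y‖ ≤ mellinR s.re y / 2) :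
    mellinK s y ≠ 0 ∧ ‖ratioK y s‖ ≤ 2 * G / (Real.exp (-2 - Y ^ 2) / 4) + ‖s‖ := by
  have hlow := le_mellinR hy hyY ha
  have he := Real.exp_pos (-2 - Y ^ 2)
  have hnorm : Real.exp (-2 - Y ^ 2) / 4 ≤ ‖mellinK s y‖ := by
    have h1 := norm_sub_norm_le (mellinR s.re y : ℂ) (mellinK s y)
    rw [norm_sub_rev, Complex.norm_real, Real.norm_of_nonneg (mellinR_pos hy _).le] at h1
    linarith
  have hne : mellinK s y ≠ 0 := by
    rw [← norm_pos_iff]; linarith [he]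
  refine ⟨hne, ?_⟩
  rw [ratioK_eq hy hne]
  refine (norm_sub_le _ _).trans (add_le_add ?_ le_rfl)
  rw [norm_div, norm_mul, Complex.norm_ofNat]
  have h2 : ‖mellinK (s + 1) y‖ ≤ G := (norm_mellinK_le _ _).trans (by simpa using hG)
  have h3 : 0 ≤ G := (norm_nonneg _).trans h2
  gcongr

/-- A strip around the real segment `|s| ≤ 1 / 4`, of height inversely proportional to `1 + |log y|`,
on which the extended integrand has no poles and is bounded. -/
theorem exists_strip_bound (Y : ℝ) : ∃ r > 0, ∃ C, ∀ y, 0 < y → y ≤ Y → ∀ s : ℂ,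
    |s.re| ≤ 1 / 4 → |s.im| * (1 + |Real.log y|) ≤ r → mellinK s y ≠ 0 ∧ ‖ratioK y s‖ ≤ C := by
  set c := Real.exp (-2 - Y ^ 2) / 2 with hc
  have hc0 : 0 < c := by positivity
  set C₁ : ℝ := 2 * (Real.Gamma (1 / 2) + Real.Gamma 1) +
    2 * ((1 + |Y|) * (Real.Gamma (1 / 4) + Real.Gamma (1 / 2))) with hC₁
  have hG1 := Real.Gamma_pos_of_pos (s := 1 / 2) (by norm_num)
  have hG2 := Real.Gamma_pos_of_pos (s := 1) (by norm_num)
  have hG3 := Real.Gamma_pos_of_pos (s := 1 / 4) (by norm_num)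
  have hC₁0 : 0 < C₁ := by positivity
  set k : ℝ := 2 + C₁ / c with hk
  have hk0 : 2 ≤ k := by rw [hk]; linarith [div_pos hC₁0 hc0]
  -- The case of non-negative real part; the other one follows by reflection.
  have main : ∀ y, 0 < y → y ≤ Y → ∀ s : ℂ, 0 ≤ s.re → s.re ≤ 1 / 4 →
      |s.im| * (1 + |Real.log y|) ≤ 1 / (2 * k) → mellinK s y ≠ 0 ∧ ‖ratioK y s‖ ≤
        2 * (Real.Gamma 1 + Real.Gamma 2) / (Real.exp (-2 - Y ^ 2) / 4) + 1 := by
    intro y hy hyY s h0 h1 him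
    have hlog : ∀ u : ℝ, 0 < u → |Real.log u| ≤
        2 * |Real.log y| + 2 * u ^ (1 / 2 : ℝ) + 2 * y * u ^ (-(1 / 2) : ℝ) := by
      intro u hu
      have e1 := Real.log_le_rpow_div hu.le (ε := 1 / 2) (by norm_num)
      have e2 := Real.log_le_rpow_div (x := y ^ 2 / u) (by positivity) (ε := 1 / 2) (by norm_num)
      have e3 : (y ^ 2 / u) ^ (1 / 2 : ℝ) = y * u ^ (-(1 / 2) : ℝ) := by
        rw [Real.div_rpow (by positivity) hu.le, Real.rpow_neg hu.le, ← Real.sqrt_eq_rpow (y ^ 2),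
          Real.sqrt_sq hy.le, div_eq_mul_inv]
      rw [e3, Real.log_div (by positivity) hu.ne', Real.log_pow] at e2
      have e4 : 0 ≤ u ^ (1 / 2 : ℝ) := by positivity
      have e5 : 0 ≤ y * u ^ (-(1 / 2) : ℝ) := by positivity
      have e6 := neg_abs_le (Real.log y)
      have e7 := abs_nonneg (Real.log y)
      rw [abs_le]
      push_cast at e2
      constructor <;> linarith
    have key := norm_mellinK_sub_le hy s hlog
    have b1 : mellinR (s.re + 1 / 2) y ≤ Real.Gamma (1 / 2) + Real.Gamma 1 :=
      mellinR_le_Gamma_add_Gamma hy (by norm_num) (by linarith) (by linarith)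
    have b2 : y * mellinR (s.re - 1 / 2) y ≤ (1 + |Y|) * (Real.Gamma (1 / 4) + Real.Gamma (1 / 2)) := by
      have e1 : y * mellinR (s.re - 1 / 2) y = y ^ (2 * s.re) * mellinR (1 / 2 - s.re) y := by
        rw [show s.re - 1 / 2 = -(1 / 2 - s.re) by ring, mellinR_neg hy, ← mul_assoc,
          show -(2 * (1 / 2 - s.re)) = 2 * s.re - 1 by ring, Real.rpow_sub_one hy.ne',
          mul_div_cancel₀ _ hy.ne']
      rw [e1]
      have e2 : y ^ (2 * s.re) ≤ 1 + |Y| := by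
        refine (rpow_le_add (p := 0) (q := 1) hy (by linarith) (by linarith)).trans ?_
        rw [Real.rpow_zero, Real.rpow_one]
        linarith [le_abs_self Y]
      exact mul_le_mul e2 (mellinR_le_Gamma_add_Gamma hy (by norm_num) (by linarith) (by linarith))
        (mellinR_pos hy _).le (by positivity)
    have hlow := le_mellinR hy hyY h0
    rw [← hc] at hlow
    have b3 : C₁ ≤ C₁ / c * mellinR s.re y := by
      rw [div_mul_eq_mul_div, le_div_iff₀ hc0]
      gcongr
    have hm := mellinR_pos hy s.re
    have hsub : ‖mellinK s y - mellinR s.re y‖ ≤ mellinR s.re y / 2 := by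
      calc ‖mellinK s y - mellinR s.re y‖ ≤ _ := key
        _ ≤ |s.im| * (2 * |Real.log y| * mellinR s.re y + C₁) := by
            refine mul_le_mul_of_nonneg_left ?_ (abs_nonneg _)
            rw [hC₁]; nlinarith
        _ ≤ |s.im| * ((1 + |Real.log y|) * (k * mellinR s.re y)) := by
            refine mul_le_mul_of_nonneg_left ?_ (abs_nonneg _)
            have := abs_nonneg (Real.log y)
            have e1 : C₁ ≤ (k - 2) * mellinR s.re y := by rw [hk]; linarith
            have e2 : 2 * mellinR s.re y ≤ k * mellinR s.re y := by gcongr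
            nlinarith
        _ = |s.im| * (1 + |Real.log y|) * k * mellinR s.re y := by ring
        _ ≤ 1 / (2 * k) * k * mellinR s.re y := by gcongr
        _ = mellinR s.re y / 2 := by field_simp
    obtain ⟨hne, hb⟩ := ratioK_bound_of_sub_le hy hyY h0
      (mellinR_le_Gamma_add_Gamma (p := 1) (q := 2) hy one_pos (by linarith) (by linarith)) hsub
    refine ⟨hne, hb.trans (add_le_add le_rfl ?_)⟩
    have e1 := Complex.norm_le_abs_re_add_abs_im s
    have e2 : |s.im| ≤ |s.im| * (1 + |Real.log y|) :=
      le_mul_of_one_le_right (abs_nonneg _) (by linarith [abs_nonneg (Real.log y)])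
    have e3 : 1 / (2 * k) ≤ 1 / 4 := by
      apply one_div_le_one_div_of_le <;> linarith
    rw [abs_of_nonneg h0] at e1
    linarith
  refine ⟨1 / (2 * k), by positivity,
    2 * (Real.Gamma 1 + Real.Gamma 2) / (Real.exp (-2 - Y ^ 2) / 4) + 1, fun y hy hyY s hre him => ?_⟩
  rcases le_total 0 s.re with h | h
  · exact main y hy hyY s h ((le_abs_self _).trans hre) him
  · have := main y hy hyY (-s) (by simpa using h) (by
      rw [Complex.neg_re]; exact (neg_le_abs _).trans hre) (by simpa using him)
    rwa [ratioK_neg hy, ne_eq, mellinK_neg_eq_zero_iff hy] at this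

/-- Around each positive real point there is a disc, independent of `y`, on which the extended
integrand has no poles and is bounded. -/
theorem exists_ball_bound (Y : ℝ) {a₀ : ℝ} (ha₀ : 0 < a₀) : ∃ ε > 0, ∃ C, ∀ y, 0 < y → y ≤ Y →
    ∀ s ∈ Metric.ball (a₀ : ℂ) ε, mellinK s y ≠ 0 ∧ ‖ratioK y s‖ ≤ C := by
  set c := Real.exp (-2 - Y ^ 2) / 2 with hc
  have hc0 : 0 < c := by positivity
  set δ := a₀ / 4 with hδ
  have hδ0 : 0 < δ := by positivity
  set C₁ : ℝ := 1 / δ * (2 * (Real.Gamma δ + Real.Gamma (8 * δ))) with hC₁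
  have hG1 := Real.Gamma_pos_of_pos hδ0
  have hG2 := Real.Gamma_pos_of_pos (s := 8 * δ) (by positivity)
  have hC₁0 : 0 < C₁ := by positivity
  refine ⟨min (2 * δ) (c / (2 * C₁)), by positivity,
    2 * (Real.Gamma 1 + Real.Gamma (8 * δ + 1)) / (Real.exp (-2 - Y ^ 2) / 4) + (a₀ + 2 * δ),
    fun y hy hyY s hs => ?_⟩
  rw [mem_ball_iff_norm, lt_min_iff] at hs
  obtain ⟨hs1, hs2⟩ := hs
  have hre := (Complex.abs_re_le_norm (s - a₀)).trans_lt hs1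
  have him := (Complex.abs_im_le_norm (s - a₀)).trans_lt hs2
  simp only [Complex.sub_re, Complex.ofReal_re, Complex.sub_im, Complex.ofReal_im, sub_zero] at hre him
  rw [abs_lt] at hre
  obtain ⟨hre1, hre2⟩ := hre
  have hlog : ∀ u : ℝ, 0 < u → |Real.log u| ≤ 0 + 1 / δ * u ^ δ + 1 / δ * u ^ (-δ) := by
    intro u hu
    have e1 := Real.log_le_rpow_div hu.le hδ0
    have e2 := Real.log_le_rpow_div (inv_pos.2 hu).le hδ0
    rw [Real.log_inv, Real.inv_rpow hu.le, ← Real.rpow_neg hu.le] at e2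
    have e4 : 0 ≤ u ^ δ / δ := by positivity
    have e5 : 0 ≤ u ^ (-δ) / δ := by positivity
    rw [div_eq_inv_mul, ← one_div] at e1 e2 e4 e5
    rw [abs_le]
    constructor <;> linarith
  have key := norm_mellinK_sub_le hy s hlog
  have b1 : mellinR (s.re + δ) y ≤ Real.Gamma δ + Real.Gamma (8 * δ) :=
    mellinR_le_Gamma_add_Gamma hy hδ0 (by linarith) (by linarith)
  have b2 : mellinR (s.re - δ) y ≤ Real.Gamma δ + Real.Gamma (8 * δ) :=
    mellinR_le_Gamma_add_Gamma hy hδ0 (by linarith) (by linarith)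
  have h0 : 0 ≤ s.re := by linarith
  have hlow := le_mellinR hy hyY h0
  have hsub : ‖mellinK s y - mellinR s.re y‖ ≤ mellinR s.re y / 2 := by
    calc ‖mellinK s y - mellinR s.re y‖ ≤ _ := key
      _ ≤ |s.im| * C₁ := by
          refine mul_le_mul_of_nonneg_left ?_ (abs_nonneg _)
          rw [hC₁, zero_mul, zero_add, ← mul_add]
          gcongr
          linarith
      _ ≤ c / (2 * C₁) * C₁ := by gcongr
      _ = c / 2 := by field_simp
      _ ≤ _ := by rw [hc]; linarith
  obtain ⟨hne, hb⟩ := ratioK_bound_of_sub_le hy hyY h0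
    (mellinR_le_Gamma_add_Gamma (p := 1) (q := 8 * δ + 1) hy one_pos (by linarith) (by linarith)) hsub
  refine ⟨hne, hb.trans (add_le_add le_rfl ?_)⟩
  have := norm_sub_norm_le s (a₀ : ℂ)
  rw [Complex.norm_real, Real.norm_of_nonneg ha₀.le] at this
  linarith

/-! ### Regularity of the integral -/

/-- The derivative in the parameter of a family of measurable functions is measurable, as a limit
of difference quotients. -/
theorem aestronglyMeasurable_of_hasDerivAt {X 𝕜 E : Type*} [MeasurableSpace X] {μ : Measure X}
    [RCLike 𝕜] [NormedAddCommGroup E] [NormedSpace 𝕜 E] {f : X → 𝕜 → E} {f' : X → E} {s₀ : 𝕜}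
    (hf : ∀ᶠ s in 𝓝 s₀, AEStronglyMeasurable (fun x => f x s) μ)
    (hd : ∀ᵐ x ∂μ, HasDerivAt (f x) (f' x) s₀) : AEStronglyMeasurable f' μ := by
  have hlim : Tendsto (fun k : ℕ => (((1 : ℝ) / ((k : ℝ) + 1) : ℝ) : 𝕜)) atTop (𝓝[≠] 0) := by
    refine tendsto_nhdsWithin_iff.2 ⟨?_, Eventually.of_forall fun k => ?_⟩
    · rw [← RCLike.ofReal_zero (K := 𝕜)]
      exact (RCLike.continuous_ofReal.tendsto 0).comp tendsto_one_div_add_atTop_nhds_zero_nat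
    · simp only [mem_compl_iff, mem_singleton_iff, RCLike.ofReal_eq_zero]
      positivity
  have hlim2 : Tendsto (fun k : ℕ => s₀ + (((1 : ℝ) / ((k : ℝ) + 1) : ℝ) : 𝕜)) atTop (𝓝 s₀) := by
    simpa using (hlim.mono_right nhdsWithin_le_nhds).const_add s₀
  obtain ⟨N, hN⟩ := eventually_atTop.1 (hlim2.eventually hf)
  refine aestronglyMeasurable_of_tendsto_ae atTop (f := fun (k : ℕ) (x : X) =>
    ((((1 : ℝ) / (((k + N : ℕ) : ℝ) + 1) : ℝ) : 𝕜))⁻¹ •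
      (f x (s₀ + (((1 : ℝ) / (((k + N : ℕ) : ℝ) + 1) : ℝ) : 𝕜)) - f x s₀)) (fun k => ?_) ?_
  · exact ((hN (k + N) (by omega)).sub hf.self_of_nhds).const_smul _
  · filter_upwards [hd] with x hx
    exact ((hasDerivAt_iff_tendsto_slope_zero.1 hx).comp hlim).comp (tendsto_add_atTop_nat N)

/-- A bounded family of holomorphic functions has a holomorphic integral. -/
theorem differentiableOn_integral_of_bounded {X : Type*} [MeasurableSpace X] {μ : Measure X}
    [IsFiniteMeasure μ] {f : X → ℂ → ℂ} {U : Set ℂ} (hU : IsOpen U) {C : ℝ}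
    (hmeas : ∀ s ∈ U, AEStronglyMeasurable (fun x => f x s) μ)
    (hd : ∀ᵐ x ∂μ, DifferentiableOn ℂ (f x) U) (hC : ∀ᵐ x ∂μ, ∀ s ∈ U, ‖f x s‖ ≤ C) :
    DifferentiableOn ℂ (fun s => ∫ x, f x s ∂μ) U := by
  intro s₀ hs₀
  obtain ⟨ε, hε, hball⟩ := Metric.isOpen_iff.1 hU s₀ hs₀
  have hmeas' : ∀ᶠ s in 𝓝 s₀, AEStronglyMeasurable (fun x => f x s) μ :=
    (hU.eventually_mem hs₀).mono hmeas
  have hder : ∀ᵐ x ∂μ, ∀ s ∈ U, HasDerivAt (f x) (deriv (f x) s) s := by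
    filter_upwards [hd] with x hx s hs
    exact ((hx s hs).differentiableAt (hU.mem_nhds hs)).hasDerivAt
  have key := hasDerivAt_integral_of_dominated_loc_of_deriv_le (μ := μ) (F := fun s x => f x s)
    (F' := fun s x => deriv (f x) s) (bound := fun _ => C / (ε / 2)) (x₀ := s₀)
    (s := Metric.ball s₀ (ε / 2)) (Metric.ball_mem_nhds _ (by positivity)) hmeas' ?_ ?_ ?_ ?_ ?_
  · exact key.2.differentiableAt.differentiableWithinAt
  · refine Integrable.of_bound (hmeas s₀ hs₀) C ?_
    filter_upwards [hC] with x hx using hx s₀ hs₀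
  · refine aestronglyMeasurable_of_hasDerivAt hmeas' ?_
    filter_upwards [hder] with x hx using hx s₀ hs₀
  · filter_upwards [hd, hC] with x hx hx2 s hs
    have hsub : Metric.closedBall s (ε / 2) ⊆ U := by
      intro z hz
      refine hball ?_
      rw [Metric.mem_ball] at *
      rw [Metric.mem_closedBall] at hz
      linarith [dist_triangle z s s₀]
    exact Complex.norm_deriv_le_of_forall_mem_sphere_norm_le (by positivity)
      (hx.diffContOnCl_ball hsub) fun z hz => hx2 z (hsub (Metric.sphere_subset_closedBall hz))
  · exact integrable_const _
  · filter_upwards [hder] with x hx s hs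
    refine hx s (hball ?_)
    exact Metric.ball_subset_ball (by linarith) hs

/-- A chain of functions on an open set, each one the derivative of the one before, consists of the
iterated derivatives of its first member. -/
theorem iteratedDeriv_eqOn_of_chain {J : Set ℝ} (hJ : IsOpen J) {D : ℕ → ℝ → ℝ}
    (hD : ∀ n, ∀ a ∈ J, HasDerivAt (D n) (D (n + 1) a) a) (n : ℕ) :
    EqOn (iteratedDeriv n (D 0)) (D n) J := by
  induction n with
  | zero => intro a _; simp
  | succ n ih =>
    intro a ha
    rw [iteratedDeriv_succ, (ih.eventuallyEq_of_mem (hJ.mem_nhds ha)).deriv_eq, (hD n a ha).deriv]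

theorem contDiffOn_of_chain {J : Set ℝ} (hJ : IsOpen J) {D : ℕ → ℝ → ℝ}
    (hD : ∀ n, ∀ a ∈ J, HasDerivAt (D n) (D (n + 1) a) a) : ContDiffOn ℝ ∞ (D 0) J := by
  refine contDiffOn_of_differentiableOn_deriv fun m _ => ?_
  have h : EqOn (iteratedDerivWithin m (D 0) J) (D m) J :=
    (iteratedDerivWithin_of_isOpen hJ).trans (iteratedDeriv_eqOn_of_chain hJ hD m)
  exact DifferentiableOn.congr
    (fun a ha => (hD m a ha).differentiableAt.differentiableWithinAt) h

theorem hasDerivAt_iteratedDeriv {f : ℂ → ℂ} {s : ℂ} (hf : AnalyticAt ℂ f s) (n : ℕ) :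
    HasDerivAt (iteratedDeriv n f) (iteratedDeriv (n + 1) f s) s := by
  rw [iteratedDeriv_succ, hasDerivAt_deriv_iff, iteratedDeriv_eq_iterate]
  exact (hf.iterated_deriv n).differentiableAt

/-- Any power of `1 + |log (x / 2)|` is integrable near `0`. -/
theorem integrableOn_log_pow (η : ℝ) (hη : 0 < η) (n : ℕ) :
    IntegrableOn (fun x : ℝ => (1 + |Real.log (x / 2)|) ^ n) (Ioo 0 η) := by
  have hr : ∀ p : ℝ, -1 < p → IntegrableOn (fun x : ℝ => (x / 2) ^ p) (Ioo 0 η) := by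
    intro p hp
    have h1 : IntegrableOn (fun x : ℝ => x ^ p) (Ioo 0 η) := by
      have := (intervalIntegral.intervalIntegrable_rpow' (a := 0) (b := η) hp)
      rw [intervalIntegrable_iff_integrableOn_Ioo_of_le hη.le] at this
      exact this
    refine IntegrableOn.congr_fun (h1.mul_const (2 ^ p)⁻¹) (fun x hx => ?_) measurableSet_Ioo
    rw [Real.div_rpow hx.1.le (by norm_num), div_eq_mul_inv]
  have hb := ((hr (1 / 2) (by norm_num)).add (hr (-(1 / 2)) (by norm_num))).const_mul
    (2 ^ n * (n ! : ℝ) * Real.exp (1 / 2))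
  refine hb.mono' ?_ ?_
  · exact Measurable.aestronglyMeasurable (by fun_prop)
  · filter_upwards [self_mem_ae_restrict measurableSet_Ioo] with x hx
    have hy : 0 < x / 2 := by have := hx.1; positivity
    set l := |Real.log (x / 2)| with hl
    have hl0 : 0 ≤ l := abs_nonneg _
    rw [Real.norm_of_nonneg (by positivity)]
    have h1 := Real.pow_div_factorial_le_exp ((1 + l) / 2) (by positivity) n
    rw [div_le_iff₀ (by positivity), div_pow, div_le_iff₀ (by positivity)] at h1
    have h2 : Real.exp ((1 + l) / 2) ≤
        Real.exp (1 / 2) * ((x / 2) ^ (1 / 2 : ℝ) + (x / 2) ^ (-(1 / 2) : ℝ)) := by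
      rw [add_div, Real.exp_add]
      gcongr
      rw [Real.rpow_def_of_pos hy, Real.rpow_def_of_pos hy]
      rcases abs_cases (Real.log (x / 2)) with ⟨h, _⟩ | ⟨h, _⟩
      · rw [hl, h, show Real.log (x / 2) / 2 = Real.log (x / 2) * (1 / 2) by ring]
        linarith [Real.exp_pos (Real.log (x / 2) * -(1 / 2))]
      · rw [hl, h, show -Real.log (x / 2) / 2 = Real.log (x / 2) * -(1 / 2) by ring]
        linarith [Real.exp_pos (Real.log (x / 2) * (1 / 2))]
    calc (1 + l) ^ n ≤ Real.exp ((1 + l) / 2) * (n ! : ℝ) * 2 ^ n := h1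
      _ ≤ Real.exp (1 / 2) * ((x / 2) ^ (1 / 2 : ℝ) + (x / 2) ^ (-(1 / 2) : ℝ)) * (n ! : ℝ) * 2 ^ n := by
          gcongr
      _ = _ := by simp only [Pi.add_apply]; ring

/-- Uniform control of the Taylor coefficients of the extended integrand on a real neighbourhood
of `0`: the radius of the Cauchy estimate is of order `1 / (1 + |log (x / 2)|)`. -/
theorem exists_iteratedDeriv_bound (Y : ℝ) : ∃ ρ > 0, ∃ C, 0 ≤ C ∧ ∀ y, 0 < y → y ≤ Y →
    ∀ a ∈ Ioo (-1 / 8 : ℝ) (1 / 8), AnalyticAt ℂ (ratioK y) a ∧ ∀ n : ℕ,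
      ‖iteratedDeriv n (ratioK y) (a : ℂ)‖ ≤ (n ! : ℝ) * C / ρ ^ n * (1 + |Real.log y|) ^ n := by
  obtain ⟨r, hr, C, h⟩ := exists_strip_bound Y
  refine ⟨min (1 / 8) (r / 2), by positivity, |C|, abs_nonneg _, fun y hy hyY a ha => ?_⟩
  set ρ := min (1 / 8) (r / 2) with hρ
  have hρ0 : 0 < ρ := by positivity
  have hρ1 : ρ ≤ 1 / 8 := min_le_left _ _
  have hρ2 : ρ ≤ r / 2 := min_le_right _ _
  set Λ := 1 + |Real.log y| with hΛ
  have hΛ1 : 1 ≤ Λ := by rw [hΛ]; linarith [abs_nonneg (Real.log y)]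
  have hR0 : 0 < ρ / Λ := by positivity
  have hR1 : ρ / Λ ≤ ρ := div_le_self hρ0.le hΛ1
  have hin : ∀ s : ℂ, s ∈ Metric.closedBall (a : ℂ) (ρ / Λ) →
      |s.re| ≤ 1 / 4 ∧ |s.im| * Λ ≤ r := by
    intro s hs
    rw [mem_closedBall_iff_norm] at hs
    have hre := (Complex.abs_re_le_norm (s - a)).trans hs
    have him := (Complex.abs_im_le_norm (s - a)).trans hs
    simp only [Complex.sub_re, Complex.ofReal_re, Complex.sub_im, Complex.ofReal_im, sub_zero]
      at hre him
    rw [abs_le] at hre ⊢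
    have := ha.1
    have := ha.2
    refine ⟨⟨by linarith, by linarith⟩, ?_⟩
    rw [le_div_iff₀ (by positivity)] at him
    linarith
  have hdiff : ∀ s ∈ Metric.closedBall (a : ℂ) (ρ / Λ), DifferentiableAt ℂ (ratioK y) s := fun s hs =>
    differentiableAt_ratioK hy (h y hy hyY s (hin s hs).1 (hin s hs).2).1
  have hdon : DifferentiableOn ℂ (ratioK y) (Metric.closedBall (a : ℂ) (ρ / Λ)) := fun s hs =>
    (hdiff s hs).differentiableWithinAt
  refine ⟨hdon.analyticAt (Metric.closedBall_mem_nhds _ hR0), fun n => ?_⟩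
  refine (Complex.norm_iteratedDeriv_le_of_forall_mem_sphere_norm_le (C := |C|) n hR0
    (hdon.diffContOnCl_ball le_rfl) fun z hz => ?_).trans (le_of_eq ?_)
  · have hz := Metric.sphere_subset_closedBall hz
    exact ((h y hy hyY z (hin z hz).1 (hin z hz).2).2).trans (le_abs_self C)
  · rw [div_pow]; field_simp

/-- The part `∫_0^η (x K_{α-1}(x) / K_α(x) + α) dx` of the integral that is even in `α`. -/
noncomputable def evenF (η α : ℝ) : ℝ := F η α + η * α

theorem integrableOn_ratioK (η α : ℝ) : IntegrableOn (fun x => ratioK (x / 2) α) (Ioo 0 η) := by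
  have hC : ∃ C, ∀ y, 0 < y → y ≤ η / 2 → ‖ratioK y α‖ ≤ C := by
    rcases lt_trichotomy α 0 with h | rfl | h
    · obtain ⟨ε, hε, C, hC⟩ := exists_ball_bound (η / 2) (neg_pos.2 h)
      refine ⟨C, fun y hy hyY => ?_⟩
      have := (hC y hy hyY ((-α : ℝ) : ℂ) (Metric.mem_ball_self hε)).2
      rwa [Complex.ofReal_neg, ratioK_neg hy] at this
    · obtain ⟨r, hr, C, hC⟩ := exists_strip_bound (η / 2)
      exact ⟨C, fun y hy hyY => (hC y hy hyY _ (by simp) (by simpa using hr.le)).2⟩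
    · obtain ⟨ε, hε, C, hC⟩ := exists_ball_bound (η / 2) h
      exact ⟨C, fun y hy hyY => (hC y hy hyY _ (Metric.mem_ball_self hε)).2⟩
  obtain ⟨C, hC⟩ := hC
  refine IntegrableOn.of_bound (by simp) ?_ C ?_
  · exact ((measurable_ratioK α).comp (by fun_prop)).aestronglyMeasurable
  · filter_upwards [self_mem_ae_restrict measurableSet_Ioo] with x hx
    exact hC _ (by linarith [hx.1]) (by linarith [hx.2])

theorem ratioK_half_eq {η α x : ℝ} (hx : x ∈ Ioo 0 η) :
    ratioK (x / 2) α = ((integrand α x + α : ℝ) : ℂ) := by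
  have h := ratioK_ofReal (show 0 < x / 2 by linarith [hx.1]) α
  rwa [show 2 * (x / 2) = x by ring] at h

theorem integrableOn_integrand (η α : ℝ) : IntegrableOn (integrand α) (Ioo 0 η) := by
  have h1 : IntegrableOn (fun x => (ratioK (x / 2) α).re - α) (Ioo 0 η) :=
    (integrableOn_ratioK η α).re.sub (integrableOn_const (by simp))
  refine h1.congr_fun (fun x hx => ?_) measurableSet_Ioo
  simp only [ratioK_half_eq hx, Complex.ofReal_re]
  ring

theorem evenF_eq {η : ℝ} (hη : 0 < η) (α : ℝ) :
    evenF η α = (∫ x in Ioo 0 η, ratioK (x / 2) α).re := by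
  rw [setIntegral_congr_fun measurableSet_Ioo fun x hx => ratioK_half_eq hx, integral_complex_ofReal,
    Complex.ofReal_re, integral_add (integrableOn_integrand η α) (integrableOn_const (by simp))]
  simp [evenF, F, hη.le]

theorem evenF_neg {η : ℝ} (hη : 0 < η) (α : ℝ) : evenF η (-α) = evenF η α := by
  rw [evenF_eq hη, evenF_eq hη, setIntegral_congr_fun measurableSet_Ioo fun x hx => ?_]
  simp only [Complex.ofReal_neg, ratioK_neg (show 0 < x / 2 by linarith [hx.1])]

theorem analyticAt_evenF {η : ℝ} (hη : 0 < η) {α : ℝ} (hα : α ≠ 0) :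
    AnalyticAt ℝ (evenF η) α := by
  have pos : ∀ α : ℝ, 0 < α → AnalyticAt ℝ (evenF η) α := by
    intro α hα
    obtain ⟨ε, hε, C, hC⟩ := exists_ball_bound (η / 2) hα
    have hd : DifferentiableOn ℂ (fun s => ∫ x in Ioo 0 η, ratioK (x / 2) s)
        (Metric.ball (α : ℂ) ε) := by
      refine differentiableOn_integral_of_bounded Metric.isOpen_ball (C := C) (fun s _ => ?_) ?_ ?_
      · exact ((measurable_ratioK s).comp (by fun_prop)).aestronglyMeasurable
      · filter_upwards [self_mem_ae_restrict measurableSet_Ioo] with x hx s hs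
        have hx0 : 0 < x / 2 := by linarith [hx.1]
        exact (differentiableAt_ratioK hx0
          (hC _ hx0 (by linarith [hx.2]) s hs).1).differentiableWithinAt
      · filter_upwards [self_mem_ae_restrict measurableSet_Ioo] with x hx s hs
        exact (hC _ (by linarith [hx.1]) (by linarith [hx.2]) s hs).2
    have ha : AnalyticAt ℝ (fun s => ∫ x in Ioo 0 η, ratioK (x / 2) s) (α : ℂ) :=
      (hd.analyticAt (Metric.ball_mem_nhds _ hε)).restrictScalars
    have hcomp : AnalyticAt ℝ (fun a : ℝ => ∫ x in Ioo 0 η, ratioK (x / 2) (a : ℂ)) α :=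
      ha.fun_comp (Complex.ofRealCLM.analyticAt α)
    have hre := (Complex.reCLM.analyticAt _).fun_comp hcomp
    refine hre.congr (Eventually.of_forall fun a => ?_)
    exact (evenF_eq hη a).symm
  rcases lt_or_gt_of_ne hα with h | h
  · have h1 := pos (-α) (neg_pos.2 h)
    have h2 : AnalyticAt ℝ (fun a : ℝ => evenF η (-a)) α :=
      h1.fun_comp analyticAt_id.neg
    exact h2.congr (Eventually.of_forall fun a => evenF_neg hη a)
  · exact pos α h

/-- Differentiation under the integral sign to all orders near `0`. -/
theorem evenF_chain {η : ℝ} (hη : 0 < η) (n : ℕ) {a : ℝ} (ha : a ∈ Ioo (-1 / 8 : ℝ) (1 / 8)) :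
    IntegrableOn (fun x => iteratedDeriv n (ratioK (x / 2)) (a : ℂ)) (Ioo 0 η) ∧
    HasDerivAt (fun a : ℝ => ∫ x in Ioo 0 η, iteratedDeriv n (ratioK (x / 2)) (a : ℂ))
      (∫ x in Ioo 0 η, iteratedDeriv (n + 1) (ratioK (x / 2)) (a : ℂ)) a := by
  obtain ⟨ρ, hρ, C, hC0, hC⟩ := exists_iteratedDeriv_bound (η / 2)
  have hder : ∀ n, ∀ᵐ x ∂(volume.restrict (Ioo 0 η)), ∀ b ∈ Ioo (-1 / 8 : ℝ) (1 / 8),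
      HasDerivAt (fun a : ℝ => iteratedDeriv n (ratioK (x / 2)) (a : ℂ))
        (iteratedDeriv (n + 1) (ratioK (x / 2)) (b : ℂ)) b := by
    intro n
    filter_upwards [self_mem_ae_restrict measurableSet_Ioo] with x hx b hb
    have := hasDerivAt_iteratedDeriv
      (hC (x / 2) (by linarith [hx.1]) (by linarith [hx.2]) b hb).1 n
    exact this.comp_ofReal
  have hmeas : ∀ n, ∀ b ∈ Ioo (-1 / 8 : ℝ) (1 / 8), AEStronglyMeasurable
      (fun x => iteratedDeriv n (ratioK (x / 2)) (b : ℂ)) (volume.restrict (Ioo 0 η)) := by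
    intro n
    induction n with
    | zero =>
      intro b _
      simp only [iteratedDeriv_zero]
      exact ((measurable_ratioK b).comp (by fun_prop)).aestronglyMeasurable
    | succ n ih =>
      intro b hb
      refine aestronglyMeasurable_of_hasDerivAt (s₀ := b)
        (f := fun x (a : ℝ) => iteratedDeriv n (ratioK (x / 2)) (a : ℂ)) ?_ ?_
      · exact (isOpen_Ioo.eventually_mem hb).mono ih
      · filter_upwards [hder n] with x hx using hx b hb
  have hbound : ∀ n, ∀ᵐ x ∂(volume.restrict (Ioo 0 η)), ∀ b ∈ Ioo (-1 / 8 : ℝ) (1 / 8),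
      ‖iteratedDeriv n (ratioK (x / 2)) (b : ℂ)‖ ≤
        (n ! : ℝ) * C / ρ ^ n * (1 + |Real.log (x / 2)|) ^ n := by
    intro n
    filter_upwards [self_mem_ae_restrict measurableSet_Ioo] with x hx b hb
    exact (hC (x / 2) (by linarith [hx.1]) (by linarith [hx.2]) b hb).2 n
  have hint : ∀ n, IntegrableOn (fun x => iteratedDeriv n (ratioK (x / 2)) (a : ℂ)) (Ioo 0 η) := by
    intro n
    refine ((integrableOn_log_pow η hη n).const_mul ((n ! : ℝ) * C / ρ ^ n)).mono' (hmeas n a ha) ?_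
    filter_upwards [hbound n] with x hx using hx a ha
  refine ⟨hint n, ?_⟩
  exact (hasDerivAt_integral_of_dominated_loc_of_deriv_le (μ := volume.restrict (Ioo 0 η))
    (F := fun (b : ℝ) x => iteratedDeriv n (ratioK (x / 2)) (b : ℂ))
    (F' := fun (b : ℝ) x => iteratedDeriv (n + 1) (ratioK (x / 2)) (b : ℂ))
    (bound := fun x => ((n + 1)! : ℝ) * C / ρ ^ (n + 1) * (1 + |Real.log (x / 2)|) ^ (n + 1))
    (x₀ := a) (s := Ioo (-1 / 8 : ℝ) (1 / 8)) (isOpen_Ioo.mem_nhds ha)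
    ((isOpen_Ioo.eventually_mem ha).mono (hmeas n)) (hint n) (hmeas (n + 1) a ha)
    (hbound (n + 1)) ((integrableOn_log_pow η hη (n + 1)).const_mul _) (hder n)).2

theorem evenF_chain_re {η : ℝ} (hη : 0 < η) (n : ℕ) (a : ℝ) (ha : a ∈ Ioo (-1 / 8 : ℝ) (1 / 8)) :
    HasDerivAt (fun a : ℝ => (∫ x in Ioo 0 η, iteratedDeriv n (ratioK (x / 2)) (a : ℂ)).re)
      (∫ x in Ioo 0 η, iteratedDeriv (n + 1) (ratioK (x / 2)) (a : ℂ)).re a :=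
  Complex.reCLM.hasFDerivAt.comp_hasDerivAt a (evenF_chain hη n ha).2

theorem evenF_eq_zeroth {η : ℝ} (hη : 0 < η) :
    evenF η = fun a : ℝ => (∫ x in Ioo 0 η, iteratedDeriv 0 (ratioK (x / 2)) (a : ℂ)).re := by
  funext a
  simp only [iteratedDeriv_zero, evenF_eq hη]

theorem contDiffOn_evenF {η : ℝ} (hη : 0 < η) :
    ContDiffOn ℝ ∞ (evenF η) (Ioo (-1 / 8 : ℝ) (1 / 8)) := by
  rw [evenF_eq_zeroth hη]
  exact contDiffOn_of_chain isOpen_Ioo (D := fun n (a : ℝ) =>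
    (∫ x in Ioo 0 η, iteratedDeriv n (ratioK (x / 2)) (a : ℂ)).re) fun n a ha =>
      evenF_chain_re hη n a ha

theorem contDiffAt_evenF {η : ℝ} (hη : 0 < η) : ContDiffAt ℝ ∞ (evenF η) 0 :=
  (contDiffOn_evenF hη).contDiffAt (Ioo_mem_nhds (by norm_num) (by norm_num))

theorem iteratedDeriv_evenF {η : ℝ} (hη : 0 < η) (n : ℕ) :
    iteratedDeriv n (evenF η) 0 = (∫ x in Ioo 0 η, iteratedDeriv n (ratioK (x / 2)) 0).re := by
  rw [evenF_eq_zeroth hη]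
  have := iteratedDeriv_eqOn_of_chain isOpen_Ioo (D := fun n (a : ℝ) =>
    (∫ x in Ioo 0 η, iteratedDeriv n (ratioK (x / 2)) (a : ℂ)).re)
    (fun n a ha => evenF_chain_re hη n a ha) n
    (show (0 : ℝ) ∈ Ioo (-1 / 8 : ℝ) (1 / 8) by constructor <;> norm_num)
  simpa using this

theorem F_eq_evenF_sub (η : ℝ) : F η = fun α => evenF η α - η * α := by
  funext α; simp [evenF]

theorem analyticAt_F {η : ℝ} (hη : 0 < η) {α : ℝ} (hα : α ≠ 0) : AnalyticAt ℝ (F η) α := by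
  rw [F_eq_evenF_sub]
  exact (analyticAt_evenF hη hα).sub (analyticAt_const.mul analyticAt_id)

theorem contDiffAt_F {η : ℝ} (hη : 0 < η) (α : ℝ) : ContDiffAt ℝ ∞ (F η) α := by
  rcases eq_or_ne α 0 with rfl | h
  · rw [F_eq_evenF_sub]
    exact (contDiffAt_evenF hη).sub (contDiffAt_const.mul contDiffAt_id)
  · exact (analyticAt_F hη h).contDiffAt

theorem iteratedDeriv_evenF_odd {η : ℝ} (hη : 0 < η) {n : ℕ} (hn : Odd n) :
    iteratedDeriv n (evenF η) 0 = 0 := by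
  have h := iteratedDeriv_comp_neg n (evenF η) 0
  simp only [evenF_neg hη, neg_zero, hn.neg_one_pow, neg_smul, one_smul] at h
  have h' : iteratedDeriv n (evenF η) 0 = -iteratedDeriv n (evenF η) 0 := h
  linarith

theorem iteratedDeriv_F {η : ℝ} (hη : 0 < η) (n : ℕ) :
    iteratedDeriv n (F η) 0 = iteratedDeriv n (evenF η) 0 - if n = 1 then η else 0 := by
  rw [F_eq_evenF_sub, iteratedDeriv_fun_sub ((contDiffAt_evenF hη).of_le (by exact_mod_cast le_top))
    (g := fun α => η * α) (contDiffAt_const.mul contDiffAt_id)]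
  congr 1
  rcases n with _ | n
  · simp
  · have : deriv (fun α : ℝ => η * α) = fun _ => η := by
      funext α
      simp
    rw [iteratedDeriv_succ', this, iteratedDeriv_const]
    simp

/-! ### The Taylor coefficients of `z coth z` -/

open Real in
/-- Quantitative non-vanishing of `sinh` in the strip `|Im z| < π`: the bound degenerates like
`1 / n` at distance `π / n` from the zeros `± i π`. -/
theorem le_norm_sinh {n : ℝ} (hn : 1 ≤ n) {z : ℂ} (hz : |z.im| ≤ π * (1 - 1 / n)) :
    2 / (π * n) * ‖z‖ ≤ ‖Complex.sinh z‖ := by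
  have hn0 : 0 < n := by linarith
  set a := z.re with ha
  set b := z.im with hb
  have hsq : ‖Complex.sinh z‖ ^ 2 = Real.sinh a ^ 2 + Real.sin b ^ 2 := by
    have h1 : Complex.sinh z = ((Real.sinh a * Real.cos b : ℝ) : ℂ) +
        ((Real.cosh a * Real.sin b : ℝ) : ℂ) * Complex.I := by
      conv_lhs => rw [← Complex.re_add_im z, Complex.sinh_add, Complex.sinh_mul_I,
        Complex.cosh_mul_I]
      push_cast
      ring
    rw [h1, ← Complex.normSq_eq_norm_sq, Complex.normSq_add_mul_I]
    have h2 := Real.cosh_sq a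
    have h3 := Real.sin_sq_add_cos_sq b
    have h4 : Real.cos b ^ 2 = 1 - Real.sin b ^ 2 := by linarith
    rw [mul_pow, mul_pow, h2, h4]; ring
  have hsin : 2 / (π * n) * |b| ≤ |Real.sin b| := by
    have hbpi : |b| ≤ π := hz.trans (by
      have : 0 < 1 / n := by positivity
      nlinarith [Real.pi_pos])
    rw [Real.abs_sin_eq_sin_abs_of_abs_le_pi hbpi]
    rcases le_total |b| (π / 2) with h | h
    · refine le_trans ?_ (Real.mul_le_sin (abs_nonneg b) h)
      gcongr
      exact le_mul_of_one_le_right Real.pi_pos.le hn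
    · rw [← Real.sin_pi_sub]
      refine le_trans ?_ (Real.mul_le_sin (by linarith) (by linarith))
      have h1 : π / n ≤ π - |b| := by
        have : π * (1 - 1 / n) = π - π / n := by field_simp
        linarith
      calc 2 / (π * n) * |b| ≤ 2 / (π * n) * π := by gcongr
        _ = 2 / π * (π / n) := by field_simp
        _ ≤ _ := by gcongr
  have hsinh : |a| ≤ |Real.sinh a| := by
    rw [Real.abs_sinh]
    exact Real.self_le_sinh_iff.2 (abs_nonneg a)
  have hk : 2 / (π * n) ≤ 1 := by
    rw [div_le_one (by positivity)]
    nlinarith [Real.two_le_pi]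
  refine le_of_sq_le_sq ?_ (norm_nonneg _)
  rw [hsq, mul_pow, ← Complex.normSq_eq_norm_sq, Complex.normSq_apply, ← ha, ← hb]
  have e1 : (2 / (π * n)) ^ 2 * a ^ 2 ≤ Real.sinh a ^ 2 := by
    rw [← sq_abs a, ← sq_abs (Real.sinh a), ← mul_pow]
    refine pow_le_pow_left₀ (by positivity) (le_trans ?_ hsinh) 2
    exact mul_le_of_le_one_left (abs_nonneg a) hk
  have e2 : (2 / (π * n)) ^ 2 * b ^ 2 ≤ Real.sin b ^ 2 := by
    rw [← sq_abs b, ← sq_abs (Real.sin b), ← mul_pow]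
    exact pow_le_pow_left₀ (by positivity) hsin 2
  linarith

theorem sinh_ne_zero_of_abs_im_lt_pi {z : ℂ} (hz : z ≠ 0) (him : |z.im| < Real.pi) :
    Complex.sinh z ≠ 0 := by
  have hpi := Real.pi_pos
  have hd : 0 < Real.pi - |z.im| := by linarith
  have h := le_norm_sinh (n := Real.pi / (Real.pi - |z.im|)) (z := z)
    (by rw [le_div_iff₀ hd]; linarith [abs_nonneg z.im]) (by
      rw [one_div_div]
      field_simp
      linarith)
  rw [← norm_pos_iff]
  refine lt_of_lt_of_le ?_ h
  have := norm_pos_iff.2 hz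
  positivity

/-- The function `z coth z`, with its removable singularity at `0` filled in. -/
noncomputable def zcoth (z : ℂ) : ℂ := Complex.cosh z / dslope Complex.sinh 0 z

theorem dslope_sinh_of_ne {z : ℂ} (hz : z ≠ 0) : dslope Complex.sinh 0 z = Complex.sinh z / z := by
  rw [dslope_of_ne _ hz, slope_def_field, Complex.sinh_zero]
  simp

theorem dslope_sinh_zero : dslope Complex.sinh 0 0 = 1 := by
  rw [dslope_same, Complex.deriv_sinh, Complex.cosh_zero]

theorem zcoth_of_ne {z : ℂ} (hz : z ≠ 0) :
    zcoth z = z * (Complex.cosh z / Complex.sinh z) := by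
  rw [zcoth, dslope_sinh_of_ne hz]
  rw [div_div_eq_mul_div]
  ring

theorem zcoth_zero : zcoth 0 = 1 := by
  rw [zcoth, dslope_sinh_zero, Complex.cosh_zero, div_one]

theorem differentiableAt_zcoth {z : ℂ} (hz : ‖z‖ < Real.pi) : DifferentiableAt ℂ zcoth z := by
  have hd : Differentiable ℂ (dslope Complex.sinh 0) := by
    rw [← differentiableOn_univ, Complex.differentiableOn_dslope univ_mem, differentiableOn_univ]
    exact Complex.differentiable_sinh
  refine (Complex.differentiable_cosh z).div (hd z) ?_
  rcases eq_or_ne z 0 with rfl | h0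
  · rw [dslope_sinh_zero]; exact one_ne_zero
  · rw [dslope_sinh_of_ne h0]
    exact div_ne_zero (sinh_ne_zero_of_abs_im_lt_pi h0 ((Complex.abs_im_le_norm z).trans_lt hz)) h0

/-- The partial fraction expansion of `z coth z` without the terms of the poles `± i π`. -/
noncomputable def cothTail (z : ℂ) : ℂ :=
  ∑' n : ℕ, 2 * z ^ 2 / (z ^ 2 + ((n : ℂ) + 2) ^ 2 * (Real.pi : ℂ) ^ 2)

theorem norm_cothTail_term_le {z : ℂ} (hz : ‖z‖ < 7 / 4 * Real.pi) (n : ℕ) :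
    z ^ 2 + ((n : ℂ) + 2) ^ 2 * (Real.pi : ℂ) ^ 2 ≠ 0 ∧
    ‖2 * z ^ 2 / (z ^ 2 + ((n : ℂ) + 2) ^ 2 * (Real.pi : ℂ) ^ 2)‖ ≤
      30 * (1 / ((n + 2 : ℕ) : ℝ) ^ 2) := by
  have hpi := Real.pi_pos
  have hz2 : ‖z‖ ^ 2 ≤ 49 / 16 * Real.pi ^ 2 := by
    have := pow_le_pow_left₀ (norm_nonneg z) hz.le 2
    nlinarith
  set m : ℝ := ((n + 2 : ℕ) : ℝ) with hm
  have hm2 : 2 ≤ m := by rw [hm]; push_cast; linarith [Nat.cast_nonneg (α := ℝ) n]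
  have hcast : ((n : ℂ) + 2) ^ 2 * (Real.pi : ℂ) ^ 2 = ((m ^ 2 * Real.pi ^ 2 : ℝ) : ℂ) := by
    rw [hm]; push_cast; rfl
  have hlow : m ^ 2 * Real.pi ^ 2 * (15 / 64) ≤
      ‖z ^ 2 + ((n : ℂ) + 2) ^ 2 * (Real.pi : ℂ) ^ 2‖ := by
    rw [hcast]
    have h1 := norm_sub_norm_le ((m ^ 2 * Real.pi ^ 2 : ℝ) : ℂ) (-(z ^ 2))
    rw [sub_neg_eq_add, add_comm, norm_neg, norm_pow, Complex.norm_real,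
      Real.norm_of_nonneg (by positivity), add_comm] at h1
    have h2 : 4 * Real.pi ^ 2 ≤ m ^ 2 * Real.pi ^ 2 := by
      have : 2 ^ 2 ≤ m ^ 2 := pow_le_pow_left₀ (by norm_num) hm2 2
      nlinarith [sq_nonneg Real.pi]
    rw [add_comm (z ^ 2)]
    linarith
  have hpos : 0 < m ^ 2 * Real.pi ^ 2 * (15 / 64) := by positivity
  refine ⟨norm_pos_iff.1 (hpos.trans_le hlow), ?_⟩
  rw [norm_div, norm_mul, norm_pow, Complex.norm_ofNat]
  calc 2 * ‖z‖ ^ 2 / ‖z ^ 2 + ((n : ℂ) + 2) ^ 2 * (Real.pi : ℂ) ^ 2‖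
      ≤ 2 * (49 / 16 * Real.pi ^ 2) / (m ^ 2 * Real.pi ^ 2 * (15 / 64)) := by gcongr
    _ = (392 / 15) * (1 / m ^ 2) := by field_simp; norm_num
    _ ≤ 30 * (1 / m ^ 2) := by gcongr; norm_num

theorem summable_cothTail_bound : Summable fun n : ℕ => 30 * (1 / ((n + 2 : ℕ) : ℝ) ^ 2) :=
  ((summable_nat_add_iff 2).2 (Real.summable_one_div_nat_pow.2 one_lt_two)).mul_left 30

theorem differentiableOn_cothTail :
    DifferentiableOn ℂ cothTail (Metric.ball 0 (7 / 4 * Real.pi)) := by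
  refine Complex.differentiableOn_tsum_of_summable_norm summable_cothTail_bound (fun n => ?_)
    Metric.isOpen_ball fun n z hz => (norm_cothTail_term_le (by simpa using hz) n).2
  intro z hz
  refine DifferentiableAt.differentiableWithinAt ?_
  refine DifferentiableAt.div (by fun_prop) (by fun_prop) ?_
  exact (norm_cothTail_term_le (by simpa using hz) n).1

theorem norm_cothTail_le {z : ℂ} (hz : ‖z‖ < 7 / 4 * Real.pi) :
    ‖cothTail z‖ ≤ ∑' n : ℕ, 30 * (1 / ((n + 2 : ℕ) : ℝ) ^ 2) :=
  tsum_of_norm_bounded summable_cothTail_bound.hasSum fun n => (norm_cothTail_term_le hz n).2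

theorem zcoth_eq {z : ℂ} (hz : ‖z‖ < Real.pi) :
    zcoth z = 3 + Real.pi * Complex.I *
      ((z - Real.pi * Complex.I)⁻¹ - (z + Real.pi * Complex.I)⁻¹) + cothTail z := by
  have hpi : (Real.pi : ℂ) ≠ 0 := by exact_mod_cast Real.pi_ne_zero
  have hI := Complex.I_ne_zero
  have hnI : ‖(Real.pi : ℂ) * Complex.I‖ = Real.pi := by
    rw [norm_mul, Complex.norm_I, mul_one, Complex.norm_real, Real.norm_of_nonneg Real.pi_pos.le]
  have hm : z - Real.pi * Complex.I ≠ 0 := by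
    intro h
    rw [sub_eq_zero.1 h, hnI] at hz
    exact lt_irrefl _ hz
  have hp : z + Real.pi * Complex.I ≠ 0 := by
    intro h
    rw [eq_neg_of_add_eq_zero_left h, norm_neg, hnI] at hz
    exact lt_irrefl _ hz
  rcases eq_or_ne z 0 with rfl | h0
  · have h : cothTail 0 = 0 := by simp [cothTail]
    rw [zcoth_zero, h]
    field_simp
    ring
  set x : ℂ := Complex.I * z / Real.pi with hx
  have hpx : Real.pi * x = z * Complex.I := by rw [hx]; field_simp
  have hx0 : x ≠ 0 := by
    intro h; rw [h, mul_zero] at hpx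
    exact mul_ne_zero h0 hI hpx.symm
  have hxZ : x ∈ Complex.integerComplement := by
    rw [Complex.mem_integerComplement_iff]
    rintro ⟨k, hk⟩
    have hn : ‖x‖ < 1 := by
      rw [hx, norm_div, norm_mul, Complex.norm_I, one_mul, Complex.norm_real,
        Real.norm_of_nonneg Real.pi_pos.le, div_lt_one Real.pi_pos]
      exact hz
    rw [← hk, Complex.norm_intCast, ← Int.cast_abs] at hn
    have hk0 : k = 0 := by
      have : |k| < 1 := by exact_mod_cast hn
      rwa [Int.abs_lt_one_iff] at this
    rw [hk0] at hk
    exact hx0 (by simpa using hk.symm)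
  have hterm : ∀ n : ℕ, x * (1 / (x - ((n : ℂ) + 1)) + 1 / (x + ((n : ℂ) + 1))) =
      2 * z ^ 2 / (z ^ 2 + ((n : ℂ) + 1) ^ 2 * (Real.pi : ℂ) ^ 2) := by
    intro n
    have e1 : x - ((n : ℂ) + 1) ≠ 0 := by
      have := Complex.integerComplement_add_ne_zero hxZ (-((n : ℤ) + 1))
      push_cast at this
      rwa [sub_eq_add_neg]
    have e2 : x + ((n : ℂ) + 1) ≠ 0 := by
      have := Complex.integerComplement_add_ne_zero hxZ ((n : ℤ) + 1)
      push_cast at this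
      exact this
    have e3 : z ^ 2 + ((n : ℂ) + 1) ^ 2 * (Real.pi : ℂ) ^ 2 =
        -(Real.pi : ℂ) ^ 2 * ((x - ((n : ℂ) + 1)) * (x + ((n : ℂ) + 1))) := by
      have : z = - Complex.I * (Real.pi * x) := by
        rw [hpx]; ring_nf; rw [Complex.I_sq]; ring
      rw [this]; ring_nf; rw [Complex.I_sq]; ring
    have e4 : z ^ 2 = -(Real.pi : ℂ) ^ 2 * x ^ 2 := by
      have : z = - Complex.I * (Real.pi * x) := by
        rw [hpx]; ring_nf; rw [Complex.I_sq]; ring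
      rw [this]; ring_nf; rw [Complex.I_sq]; ring
    rw [e3, e4]
    field_simp
    ring
  have hsum := Summable.mul_left x (summable_cotTerm hxZ)
  have hrep := cot_series_rep' hxZ
  have h1 : x * (Real.pi * Complex.cot (Real.pi * x) - 1 / x) =
      ∑' n : ℕ, 2 * z ^ 2 / (z ^ 2 + ((n : ℂ) + 1) ^ 2 * (Real.pi : ℂ) ^ 2) := by
    rw [hrep, ← tsum_mul_left]
    exact tsum_congr hterm
  have hsum' : Summable fun n : ℕ =>
      2 * z ^ 2 / (z ^ 2 + ((n : ℂ) + 1) ^ 2 * (Real.pi : ℂ) ^ 2) :=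
    hsum.congr fun n => by rw [← hterm n]
  have h2 : ∑' n : ℕ, 2 * z ^ 2 / (z ^ 2 + ((n : ℂ) + 1) ^ 2 * (Real.pi : ℂ) ^ 2) =
      2 * z ^ 2 / (z ^ 2 + (Real.pi : ℂ) ^ 2) + cothTail z := by
    rw [hsum'.tsum_eq_zero_add, cothTail]
    simp only [Nat.cast_zero, zero_add, one_pow, one_mul, Nat.cast_add, Nat.cast_one]
    simp only [add_assoc, one_add_one_eq_two]
  have h3 : x * (Real.pi * Complex.cot (Real.pi * x) - 1 / x) = zcoth z - 1 := by
    have hs : Complex.sinh z ≠ 0 :=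
      sinh_ne_zero_of_abs_im_lt_pi h0 ((Complex.abs_im_le_norm z).trans_lt hz)
    have : x * (Real.pi * Complex.cot (Real.pi * x) - 1 / x) =
        Real.pi * x * Complex.cot (Real.pi * x) - 1 := by field_simp
    rw [this, hpx, Complex.cot, Complex.cos_mul_I, Complex.sin_mul_I, zcoth_of_ne h0]
    field_simp
  have h4 : 2 * z ^ 2 / (z ^ 2 + (Real.pi : ℂ) ^ 2) = 2 + Real.pi * Complex.I *
      ((z - Real.pi * Complex.I)⁻¹ - (z + Real.pi * Complex.I)⁻¹) := by
    have e : z ^ 2 + (Real.pi : ℂ) ^ 2 = (z - Real.pi * Complex.I) * (z + Real.pi * Complex.I) := by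
      ring_nf; rw [Complex.I_sq]; ring
    rw [e]
    field_simp
    ring_nf
  have h5 : zcoth z = 1 + (zcoth z - 1) := by ring
  rw [h5, ← h3, h1, h2, h4]
  ring

theorem iteratedDeriv_inv_add_zero (k : ℕ) (c : ℂ) :
    iteratedDeriv k (fun z : ℂ => (z + c)⁻¹) 0 = (-1) ^ k * (k ! : ℂ) * c ^ (-1 - k : ℤ) := by
  have h := congrFun (iter_deriv_inv_linear k (1 : ℂ) c) 0
  rw [iteratedDeriv_eq_iterate]
  simpa using h

/-- The normalised even Taylor coefficients of `z coth z`, dominated by the poles `± i π`. -/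
theorem tendsto_zcoth_coeff :
    Tendsto (fun n : ℕ => (-1 : ℂ) ^ (n + 1) * (Real.pi : ℂ) ^ (2 * n) *
      (iteratedDeriv (2 * n) zcoth 0 / ((2 * n)! : ℂ))) atTop (𝓝 2) := by
  have hpiR := Real.pi_pos
  have hpi : (Real.pi : ℂ) ≠ 0 := by exact_mod_cast Real.pi_ne_zero
  have hI := Complex.I_ne_zero
  set S := ∑' n : ℕ, 30 * (1 / ((n + 2 : ℕ) : ℝ) ^ 2) with hS
  have hpiI : (Real.pi : ℂ) * Complex.I ≠ 0 := mul_ne_zero hpi hI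
  have hpiI' : -((Real.pi : ℂ) * Complex.I) ≠ 0 := neg_ne_zero.2 hpiI
  have htail : ∀ k : ℕ, ‖iteratedDeriv k cothTail 0‖ ≤ (k ! : ℝ) * S / (3 / 2 * Real.pi) ^ k := by
    intro k
    refine Complex.norm_iteratedDeriv_le_of_forall_mem_sphere_norm_le k (by positivity)
      (differentiableOn_cothTail.diffContOnCl_ball
        (Metric.closedBall_subset_ball (by linarith))) fun z hz => norm_cothTail_le ?_
    rw [mem_sphere_zero_iff_norm] at hz
    rw [hz]; linarith
  have hcoef : ∀ n : ℕ, 1 ≤ n → iteratedDeriv (2 * n) zcoth 0 =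
      2 * (-1) ^ (n + 1) * ((2 * n)! : ℂ) / (Real.pi : ℂ) ^ (2 * n)
        + iteratedDeriv (2 * n) cothTail 0 := by
    intro n hn
    have hev : zcoth =ᶠ[𝓝 0] fun z => (3 + Real.pi * Complex.I *
        ((z + -(Real.pi * Complex.I))⁻¹ - (z + Real.pi * Complex.I)⁻¹)) + cothTail z := by
      filter_upwards [Metric.ball_mem_nhds (0 : ℂ) hpiR] with z hz
      rw [zcoth_eq (by simpa using hz), ← sub_eq_add_neg z]
    have c1 : ContDiffAt ℂ (2 * n : ℕ) (fun z : ℂ => (z + -(Real.pi * Complex.I))⁻¹) 0 :=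
      ContDiffAt.fun_inv (by fun_prop) (by simp)
    have c2 : ContDiffAt ℂ (2 * n : ℕ) (fun z : ℂ => (z + Real.pi * Complex.I)⁻¹) 0 :=
      ContDiffAt.fun_inv (by fun_prop) (by simp)
    have c3 : ContDiffAt ℂ (2 * n : ℕ) cothTail 0 :=
      (differentiableOn_cothTail.analyticAt (Metric.ball_mem_nhds _ (by positivity))).contDiffAt
    have c4 : ContDiffAt ℂ (2 * n : ℕ) (fun z : ℂ => Real.pi * Complex.I *
        ((z + -(Real.pi * Complex.I))⁻¹ - (z + Real.pi * Complex.I)⁻¹)) 0 :=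
      contDiffAt_const.mul (c1.sub c2)
    rw [hev.iteratedDeriv_eq, iteratedDeriv_fun_add (contDiffAt_const.add c4) c3,
      iteratedDeriv_fun_add contDiffAt_const c4, iteratedDeriv_const, if_neg (by omega),
      iteratedDeriv_const_mul_field, iteratedDeriv_fun_sub c1 c2,
      iteratedDeriv_inv_add_zero, iteratedDeriv_inv_add_zero]
    congr 1
    have e1 : ∀ c : ℂ, c ≠ 0 → c ^ (-1 - (2 * n : ℕ) : ℤ) = c⁻¹ * ((c ^ 2) ^ n)⁻¹ := by
      intro c hc
      rw [zpow_sub₀ hc, zpow_neg_one, zpow_natCast, div_eq_mul_inv, pow_mul]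
    rw [e1 _ hpiI, e1 _ hpiI', neg_sq, mul_pow, Complex.I_sq, mul_pow, ← pow_mul,
      Even.neg_one_pow (even_two_mul n), inv_neg, mul_inv, mul_inv, ← inv_pow (-1 : ℂ), pow_succ,
      show ((-1 : ℂ))⁻¹ = -1 by norm_num]
    field_simp
    ring
  rw [tendsto_iff_norm_sub_tendsto_zero]
  have hgeo : Tendsto (fun n : ℕ => S * (4 / 9 : ℝ) ^ n) atTop (𝓝 0) := by
    simpa using (tendsto_pow_atTop_nhds_zero_of_lt_one (r := (4 / 9 : ℝ)) (by norm_num)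
      (by norm_num)).const_mul S
  refine squeeze_zero' (Eventually.of_forall fun n => norm_nonneg _) ?_ hgeo
  filter_upwards [eventually_ge_atTop 1] with n hn
  have hf : ((2 * n)! : ℂ) ≠ 0 := by exact_mod_cast (Nat.factorial_pos _).ne'
  have e : (-1 : ℂ) ^ (n + 1) * (Real.pi : ℂ) ^ (2 * n) *
      (iteratedDeriv (2 * n) zcoth 0 / ((2 * n)! : ℂ)) - 2 =
      (-1 : ℂ) ^ (n + 1) * (Real.pi : ℂ) ^ (2 * n) *
        (iteratedDeriv (2 * n) cothTail 0 / ((2 * n)! : ℂ)) := by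
    rw [hcoef n hn]
    have : ((-1 : ℂ) ^ (n + 1)) * (-1) ^ (n + 1) = 1 := by
      rw [← mul_pow]; norm_num
    field_simp
    linear_combination (2 * ((2 * n)! : ℂ)) * this
  rw [e, norm_mul, norm_mul, norm_pow, norm_neg, norm_one, one_pow, one_mul, norm_pow,
    Complex.norm_real, Real.norm_of_nonneg hpiR.le, norm_div, Complex.norm_natCast]
  have hfR : (0 : ℝ) < ((2 * n)! : ℝ) := by exact_mod_cast Nat.factorial_pos _
  calc Real.pi ^ (2 * n) * (‖iteratedDeriv (2 * n) cothTail 0‖ / ((2 * n)! : ℝ))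
      ≤ Real.pi ^ (2 * n) * ((((2 * n)! : ℝ) * S / (3 / 2 * Real.pi) ^ (2 * n)) / ((2 * n)! : ℝ)) := by
        gcongr
        exact htail _
    _ = S * (4 / 9) ^ n := by
        rw [mul_pow, pow_mul (3 / 2 : ℝ)]
        have : ((4 : ℝ) / 9) ^ n = (((3 / 2 : ℝ) ^ 2) ^ n)⁻¹ := by
          rw [← inv_pow]; norm_num
        rw [this]
        field_simp

/-! ### Comparison with the hyperbolic cotangent -/

/-- The large parameter `log (1 / y) - γ = log (2 / x) - γ` governing `K_s(x)`, `x = 2 y`, for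
small `x`. -/
noncomputable def logScale (y : ℝ) : ℝ := -Real.log y - γ

/-- The function `e^(γ s) Γ(1 + s)`, whose linear Taylor coefficient at `0` vanishes. -/
noncomputable def normGamma (s : ℂ) : ℂ := Complex.exp (γ * s) * Complex.Gamma (1 + s)

/-- The counterpart of `normGamma` at `y > 0`. -/
noncomputable def normMellinK (y : ℝ) (s : ℂ) : ℂ := Complex.exp (γ * s) * mellinK (1 + s) y

/-- The even part `(f s + f (-s)) / 2`. -/
noncomputable def evenHalf (f : ℂ → ℂ) (s : ℂ) : ℂ := (f s + f (-s)) / 2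

/-- The odd part `(f s - f (-s)) / 2`. -/
noncomputable def oddHalf (f : ℂ → ℂ) (s : ℂ) : ℂ := (f s - f (-s)) / 2

theorem cpow_neg_mul_mellinK {y : ℝ} (hy : 0 < y) (s : ℂ) :
    (y : ℂ) ^ (-s) * mellinK (s + 1) y = Complex.exp (s * logScale y) * normMellinK y s := by
  have hy0 : (y : ℂ) ≠ 0 := by exact_mod_cast hy.ne'
  rw [normMellinK, ← mul_assoc, ← Complex.exp_add, Complex.cpow_def_of_ne_zero hy0,
    ← Complex.ofReal_log hy.le, logScale, add_comm s 1]
  push_cast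
  ring_nf

theorem cpow_neg_mul_sq_mul_mellinK {y : ℝ} (hy : 0 < y) (s : ℂ) :
    (y : ℂ) ^ (-s) * ((y : ℂ) ^ 2 * mellinK (s - 1) y) =
      Complex.exp (-(s * logScale y)) * normMellinK y (-s) := by
  have hy0 : (y : ℂ) ≠ 0 := by exact_mod_cast hy.ne'
  have h1 := cpow_neg_mul_mellinK hy (-s)
  rw [neg_neg, neg_mul] at h1
  rw [← h1, show s - 1 = -(1 - s) by ring, mellinK_neg hy, show -s + 1 = 1 - s by ring, ← mul_assoc,
    ← mul_assoc]
  congr 1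
  rw [Complex.ofReal_pow, Complex.cpow_def_of_ne_zero hy0, Complex.cpow_def_of_ne_zero hy0,
    Complex.cpow_def_of_ne_zero (pow_ne_zero 2 hy0), ← Complex.ofReal_pow,
    ← Complex.ofReal_log hy.le, ← Complex.ofReal_log (by positivity), Real.log_pow]
  have : ((y ^ 2 : ℝ) : ℂ) = Complex.exp (2 * Real.log y) := by
    rw [show (2 : ℂ) * Real.log y = ((2 * Real.log y : ℝ) : ℂ) by push_cast; rfl,
      ← Complex.ofReal_exp, two_mul, Real.exp_add, Real.exp_log hy, sq]
  rw [this, ← Complex.exp_add, ← Complex.exp_add]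
  congr 1
  push_cast
  ring

/-- The exact deviation of the extended integrand from `s coth (s L)`. -/
theorem ratioK_sub_zcoth {y : ℝ} (hy : 0 < y) {s t : ℂ} (hs : s ≠ 0) (hL : logScale y ≠ 0)
    (hE : evenHalf (normMellinK y) s ≠ 0) (ht : oddHalf (normMellinK y) s = t * evenHalf (normMellinK y) s)
    (h1 : Complex.sinh (logScale y * s) ≠ 0)
    (h2 : Complex.sinh (logScale y * s) + t * Complex.cosh (logScale y * s) ≠ 0) :
    mellinK s y ≠ 0 ∧ ratioK y s - (logScale y : ℂ)⁻¹ * zcoth (logScale y * s) =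
      -(s * t) / (Complex.sinh (logScale y * s) *
        (Complex.sinh (logScale y * s) + t * Complex.cosh (logScale y * s))) := by
  have hL' : (logScale y : ℂ) ≠ 0 := by exact_mod_cast hL
  have hy0 : (y : ℂ) ≠ 0 := by exact_mod_cast hy.ne'
  have hp : (y : ℂ) ^ (-s) ≠ 0 := by simp [Complex.cpow_eq_zero_iff, hy.ne']
  set z : ℂ := logScale y * s with hz
  set E := evenHalf (normMellinK y) s with hEdef
  have e1 : normMellinK y s = E + t * E := by
    rw [← ht, hEdef, evenHalf, oddHalf]; ring
  have e2 : normMellinK y (-s) = E - t * E := by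
    rw [← ht, hEdef, evenHalf, oddHalf]; ring
  have q1 := cpow_neg_mul_mellinK hy s
  have q2 := cpow_neg_mul_sq_mul_mellinK hy s
  rw [mul_comm s, ← hz, e1, ← Complex.cosh_add_sinh] at q1
  rw [mul_comm s, ← hz, e2, ← Complex.cosh_sub_sinh] at q2
  have hN : (y : ℂ) ^ (-s) * (s * mellinK s y) = 2 * E * (Complex.sinh z + t * Complex.cosh z) := by
    rw [← mellinK_recurrence hy s, mul_sub, q1, q2]; ring
  have hP : (y : ℂ) ^ (-s) * (mellinK (s + 1) y + (y : ℂ) ^ 2 * mellinK (s - 1) y) =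
      2 * E * (Complex.cosh z + t * Complex.sinh z) := by
    rw [mul_add, q1, q2]; ring
  have hM : mellinK s y ≠ 0 := by
    intro h
    rw [h, mul_zero, mul_zero] at hN
    exact mul_ne_zero (mul_ne_zero two_ne_zero hE) h2 hN.symm
  refine ⟨hM, ?_⟩
  have hg : ratioK y s = s * ((Complex.cosh z + t * Complex.sinh z) /
      (Complex.sinh z + t * Complex.cosh z)) := by
    rw [ratioK]
    have : (mellinK (s + 1) y + (y : ℂ) ^ 2 * mellinK (s - 1) y) / mellinK s y =
        s * (((y : ℂ) ^ (-s) * (mellinK (s + 1) y + (y : ℂ) ^ 2 * mellinK (s - 1) y)) /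
          ((y : ℂ) ^ (-s) * (s * mellinK s y))) := by
      field_simp
    rw [this, hN, hP, mul_div_mul_left _ _ (mul_ne_zero two_ne_zero hE)]
  have hz0 : z ≠ 0 := mul_ne_zero hL' hs
  rw [hg, zcoth_of_ne hz0, ← mul_assoc, hz, inv_mul_cancel_left₀ hL', ← hz, ← mul_sub,
    div_sub_div _ _ h2 h1, neg_div, mul_div_assoc, ← mul_neg, mul_comm (Complex.sinh z)]
  congr 1
  rw [← neg_div]
  congr 1
  linear_combination (-t) * Complex.cosh_sq_sub_sinh_sq z

theorem differentiableOn_normGamma : DifferentiableOn ℂ normGamma (Metric.ball 0 1) := by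
  intro s hs
  refine DifferentiableAt.differentiableWithinAt ?_
  have hG : DifferentiableAt ℂ Complex.Gamma (1 + s) := by
    refine Complex.differentiableAt_Gamma _ fun m h => ?_
    have h1 : s = -((m + 1 : ℝ) : ℂ) := by push_cast; linear_combination h
    rw [mem_ball_zero_iff, h1, norm_neg, Complex.norm_real, Real.norm_of_nonneg (by positivity)]
      at hs
    linarith [Nat.cast_nonneg (α := ℝ) m]
  have hG' : DifferentiableAt ℂ (fun s => Complex.Gamma (1 + s)) s :=
    hG.comp s (by fun_prop)
  unfold normGamma
  fun_prop

theorem analyticAt_normGamma : AnalyticAt ℂ normGamma 0 :=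
  differentiableOn_normGamma.analyticAt (Metric.ball_mem_nhds _ one_pos)

theorem hasDerivAt_normGamma : HasDerivAt normGamma 0 0 := by
  have h1 : HasDerivAt (fun s : ℂ => Complex.exp (γ * s)) γ 0 := by
    simpa using ((hasDerivAt_id (0 : ℂ)).const_mul (γ : ℂ)).cexp
  have h2 : HasDerivAt (fun s : ℂ => Complex.Gamma (1 + s)) (-γ) 0 := by
    have : HasDerivAt Complex.Gamma (-(γ : ℂ)) (1 + 0) := by
      rw [add_zero]; exact Complex.hasDerivAt_Gamma_one
    exact this.comp_const_add 1 0
  have h := h1.mul h2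
  refine h.congr_deriv ?_
  simp

/-- The odd part of `e^(γ s) Γ(1 + s)` vanishes to third order: this is where the Euler–Mascheroni
constant enters. -/
theorem oddHalf_normGamma_isBigO : oddHalf normGamma =O[𝓝 0] fun s : ℂ => ‖s‖ ^ 3 := by
  have han : AnalyticAt ℂ (oddHalf normGamma) 0 := by
    have h : AnalyticAt ℂ (fun s => normGamma (-s)) 0 := by
      have : AnalyticAt ℂ normGamma (-0) := by rw [neg_zero]; exact analyticAt_normGamma
      exact this.fun_comp (f := fun s : ℂ => -s) analyticAt_id.neg
    exact (analyticAt_normGamma.sub h).div_const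
  have h0 : oddHalf normGamma 0 = 0 := by simp [oddHalf]
  have h1 : deriv (oddHalf normGamma) 0 = 0 := by
    have hn : HasDerivAt (fun s => normGamma (-s)) 0 0 := by
      have : HasDerivAt normGamma 0 (-0) := by rw [neg_zero]; exact hasDerivAt_normGamma
      exact (this.scomp (0 : ℂ) (hasDerivAt_neg (0 : ℂ))).congr_deriv (by simp)
    have h : HasDerivAt (oddHalf normGamma) 0 0 :=
      ((hasDerivAt_normGamma.sub hn).div_const 2).congr_deriv (by simp)
    exact h.deriv
  have h2 : iteratedDeriv 2 (oddHalf normGamma) 0 = 0 := by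
    have h := iteratedDeriv_comp_neg 2 (oddHalf normGamma) 0
    have hodd : (fun s => oddHalf normGamma (-s)) = fun s => -oddHalf normGamma s := by
      funext s; simp only [oddHalf, neg_neg]; ring
    rw [hodd, iteratedDeriv_fun_neg, neg_zero] at h
    have h' : -iteratedDeriv 2 (oddHalf normGamma) 0 = iteratedDeriv 2 (oddHalf normGamma) 0 := by
      simpa using h
    have := congrArg (fun w : ℂ => w / 2) (neg_eq_iff_add_eq_zero.1 h')
    simpa using this
  have key := han.hasFPowerSeriesAt.isBigO_sub_partialSum_pow 3
  refine key.congr_left fun s => ?_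
  simp [FormalMultilinearSeries.partialSum, Finset.sum_range_succ, h0, h1, h2]

theorem Gamma_le_of_mem_Icc {a : ℝ} (h1 : 1 / 4 ≤ a) (h2 : a ≤ 3 / 4) :
    Real.Gamma a ≤ max (Real.Gamma (1 / 4)) (Real.Gamma (3 / 4)) :=
  Real.convexOn_Gamma.le_max_of_mem_Icc (by norm_num [mem_Ioi]) (by norm_num [mem_Ioi]) ⟨h1, h2⟩

/-- Uniformly near `s = 0`, `normMellinK y` is `normGamma` up to `O(y)`. -/
theorem exists_norm_normMellinK_sub_le : ∃ C > 0, ∀ y, 0 < y → ∀ s : ℂ, ‖s‖ ≤ 1 / 4 →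
    ‖normMellinK y s - normGamma s‖ ≤ C * y := by
  have hG := Real.Gamma_pos_of_pos (s := 1 / 4) (by norm_num)
  set m := max (Real.Gamma (1 / 4)) (Real.Gamma (3 / 4)) with hm
  have hm0 : 0 < m := lt_of_lt_of_le hG (le_max_left _ _)
  refine ⟨Real.exp γ * m, by positivity, fun y hy s hs => ?_⟩
  have hre := abs_le.1 ((Complex.abs_re_le_norm s).trans hs)
  have h1 := norm_mellinK_sub_Gamma_le hy (s := 1 + s) (by simp; linarith [hre.1])
  have h2 : Real.Gamma ((1 + s).re - 1 / 2) ≤ m := by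
    apply Gamma_le_of_mem_Icc <;> simp <;> linarith [hre.1, hre.2]
  have hγ : 0 < γ := lt_trans (by norm_num) Real.one_half_lt_eulerMascheroniConstant
  have h3 : ‖Complex.exp (γ * s)‖ ≤ Real.exp γ := by
    refine (Complex.norm_exp_le_exp_norm _).trans (Real.exp_le_exp.2 ?_)
    rw [norm_mul, Complex.norm_real, Real.norm_of_nonneg hγ.le]
    exact mul_le_of_le_one_right hγ.le (by linarith)
  rw [normMellinK, normGamma, ← mul_sub, norm_mul, mul_assoc]
  refine mul_le_mul h3 (h1.trans ?_) (norm_nonneg _) (Real.exp_pos _).le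
  rw [mul_comm]
  gcongr

theorem differentiable_normMellinK {y : ℝ} (hy : 0 < y) : Differentiable ℂ (normMellinK y) := by
  have h : Differentiable ℂ fun s => mellinK (1 + s) y :=
    (differentiable_mellinK hy).comp (differentiable_id.const_add 1)
  unfold normMellinK
  fun_prop

/-- For small `y` and `s` the even part of `normMellinK y` stays away from `0`, and its odd part is
`O(|s| (|s|² + y))`. -/
theorem exists_evenHalf_oddHalf_bound : ∃ ε > 0, ∃ C > 0, ∀ y, 0 < y → y ≤ ε → ∀ s : ℂ, ‖s‖ ≤ ε →
    1 / 2 ≤ ‖evenHalf (normMellinK y) s‖ ∧ ‖oddHalf (normMellinK y) s‖ ≤ C * ‖s‖ * (‖s‖ ^ 2 + y) := by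
  obtain ⟨C₁, hC₁, hsub⟩ := exists_norm_normMellinK_sub_le
  obtain ⟨C₂, hC₂, hodd⟩ := oddHalf_normGamma_isBigO.exists_pos
  rw [isBigOWith_iff] at hodd
  have heven : ∀ᶠ s in 𝓝 (0 : ℂ), ‖evenHalf normGamma s - 1‖ < 1 / 4 := by
    have hc : ContinuousAt (evenHalf normGamma) 0 := by
      have h1 : ContinuousAt normGamma 0 := analyticAt_normGamma.continuousAt
      have h2 : ContinuousAt (fun s => normGamma (-s)) 0 := by
        have : ContinuousAt normGamma (-0) := by rw [neg_zero]; exact h1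
        exact this.comp (f := fun s : ℂ => -s) continuousAt_neg
      exact (h1.add h2).div_const 2
    have hv : evenHalf normGamma 0 = 1 := by simp [evenHalf, normGamma]
    have ht := hc.tendsto
    rw [hv] at ht
    simpa [dist_eq_norm] using Metric.tendsto_nhds.1 ht (1 / 4) (by norm_num)
  obtain ⟨ε₀, hε₀, hball⟩ := Metric.eventually_nhds_iff_ball.1 (hodd.and heven)
  refine ⟨min (min (ε₀ / 2) (1 / 8)) (1 / (4 * C₁)), by positivity, C₂ + 8 * C₁, by positivity,
    fun y hy hyε s hs => ?_⟩
  have hs1 : ‖s‖ < ε₀ := lt_of_le_of_lt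
    (hs.trans ((min_le_left _ _).trans (min_le_left _ _))) (by linarith)
  have hs2 : ‖s‖ ≤ 1 / 8 := hs.trans ((min_le_left _ _).trans (min_le_right _ _))
  have hy1 : C₁ * y ≤ 1 / 4 := by
    have := hyε.trans (min_le_right _ _)
    calc C₁ * y ≤ C₁ * (1 / (4 * C₁)) := by gcongr
      _ = 1 / 4 := by field_simp
  obtain ⟨hO, hE⟩ := hball s (by simpa using hs1)
  have hdp := hsub y hy s (by linarith)
  have hdm := hsub y hy (-s) (by rw [norm_neg]; linarith)
  constructor
  · have e1 : evenHalf (normMellinK y) s - 1 = (evenHalf normGamma s - 1) +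
        ((normMellinK y s - normGamma s) + (normMellinK y (-s) - normGamma (-s))) / 2 := by
      simp only [evenHalf]; ring
    have e2 : ‖evenHalf (normMellinK y) s - 1‖ ≤ 1 / 2 := by
      rw [e1]
      refine (norm_add_le _ _).trans ?_
      rw [norm_div, Complex.norm_ofNat]
      have := norm_add_le (normMellinK y s - normGamma s) (normMellinK y (-s) - normGamma (-s))
      linarith
    have e3 := norm_sub_norm_le (1 : ℂ) (evenHalf (normMellinK y) s)
    rw [norm_one, norm_sub_rev] at e3
    linarith
  · -- The odd part of the error is `O(y)` and vanishes at `0`, so the Schwarz lemma applies.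
    set f : ℂ → ℂ := fun s => oddHalf (normMellinK y) s - oddHalf normGamma s with hf
    have hmaps : MapsTo f (Metric.ball 0 (1 / 4)) (Metric.closedBall (f 0) (C₁ * y)) := by
      intro w hw
      rw [mem_ball_zero_iff] at hw
      have h0 : f 0 = 0 := by simp [hf, oddHalf]
      rw [h0, mem_closedBall_zero_iff]
      have e1 : f w = ((normMellinK y w - normGamma w) - (normMellinK y (-w) - normGamma (-w))) / 2 := by
        simp only [hf, oddHalf]; ring
      rw [e1, norm_div, Complex.norm_ofNat]
      have := norm_sub_le (normMellinK y w - normGamma w) (normMellinK y (-w) - normGamma (-w))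
      have := hsub y hy w hw.le
      have := hsub y hy (-w) (by rw [norm_neg]; exact hw.le)
      linarith
    have hneg : MapsTo (fun s : ℂ => -s) (Metric.ball 0 (1 / 4)) (Metric.ball 0 (1 / 4)) := by
      intro w hw; simpa using hw
    have hdiff : DifferentiableOn ℂ f (Metric.ball 0 (1 / 4)) := by
      have d1 := (differentiable_normMellinK hy).differentiableOn (s := Metric.ball 0 (1 / 4))
      have d2 : DifferentiableOn ℂ (fun s => normMellinK y (-s)) (Metric.ball 0 (1 / 4)) :=
        d1.comp differentiable_neg.differentiableOn hneg
      have d0 : DifferentiableOn ℂ normGamma (Metric.ball 0 (1 / 4)) :=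
        differentiableOn_normGamma.mono (Metric.ball_subset_ball (by norm_num))
      have d3 : DifferentiableOn ℂ (fun s => normGamma (-s)) (Metric.ball 0 (1 / 4)) :=
        d0.comp differentiable_neg.differentiableOn hneg
      exact ((d1.sub d2).div_const 2).sub ((d0.sub d3).div_const 2)
    have hS := Complex.dist_le_div_mul_dist_of_mapsTo_ball hdiff hmaps
      (z := s) (by rw [mem_ball_zero_iff]; linarith)
    have h0 : f 0 = 0 := by simp [hf, oddHalf]
    rw [h0, dist_zero_right, dist_zero_right] at hS
    have e1 : oddHalf (normMellinK y) s = oddHalf normGamma s + f s := by simp only [hf]; ring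
    rw [norm_pow, norm_norm] at hO
    rw [e1]
    refine (norm_add_le _ _).trans ((add_le_add hO hS).trans ?_)
    have hn := norm_nonneg s
    have : 0 ≤ 8 * C₁ * (‖s‖ * ‖s‖ ^ 2) := by positivity
    have : 0 ≤ C₂ * (‖s‖ * y) := by positivity
    have : 0 ≤ C₁ * (‖s‖ * y) := by positivity
    calc C₂ * ‖s‖ ^ 3 + C₁ * y / (1 / 4) * ‖s‖ =
        C₂ * (‖s‖ * ‖s‖ ^ 2) + 4 * (C₁ * (‖s‖ * y)) := by ring
      _ ≤ _ := by nlinarith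

theorem iteratedDeriv_comp_mul_left {𝕜 E : Type*} [NontriviallyNormedField 𝕜]
    [NormedAddCommGroup E] [NormedSpace 𝕜 E] (n : ℕ) (f : 𝕜 → E) (c : 𝕜) :
    iteratedDeriv n (fun x => f (c * x)) = fun x => c ^ n • iteratedDeriv n f (c * x) := by
  induction n with
  | zero => simp
  | succ n ih =>
    rw [iteratedDeriv_succ, ih]
    funext x
    rw [deriv_fun_const_smul_field, deriv_comp_mul_left c (iteratedDeriv n f), smul_smul,
      ← iteratedDeriv_succ, pow_succ]

theorem norm_cosh_le_exp (z : ℂ) : ‖Complex.cosh z‖ ≤ Real.exp ‖z‖ := by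
  rw [Complex.cosh, norm_div, Complex.norm_ofNat]
  have h1 := Complex.norm_exp_le_exp_norm z
  have h2 := Complex.norm_exp_le_exp_norm (-z)
  rw [norm_neg] at h2
  have := norm_add_le (Complex.exp z) (Complex.exp (-z))
  linarith

theorem le_two_div_logScale_sq {y : ℝ} (hy : 0 < y) (hL : 0 < logScale y) :
    y ≤ 2 / logScale y ^ 2 := by
  have hγ : 0 < γ := lt_trans (by norm_num) Real.one_half_lt_eulerMascheroniConstant
  have h1 := Real.pow_div_factorial_le_exp (logScale y) hL.le 2
  have h2 : y ≤ (Real.exp (logScale y))⁻¹ := by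
    rw [← Real.exp_neg]
    conv_lhs => rw [← Real.exp_log hy]
    gcongr
    rw [logScale]; linarith
  refine h2.trans ?_
  rw [← inv_div]
  gcongr
  simpa using h1

open Real in
/-- On the disc of radius `(1 - 1 / n) π / L`, just inside the nearest poles, the extended
integrand differs from `s coth (s L)` by `O(1 / (n L))`, provided that `L` is at least of order
`n`. -/
theorem exists_ratioK_sub_zcoth_bound {δ : ℝ} (hδ : 0 < δ) : ∃ C > 0, ∃ N : ℕ, 2 ≤ N ∧ ∀ n : ℕ, N ≤ n →
    ∀ y, 0 < y → δ * n ≤ logScale y → ∀ s : ℂ, ‖(logScale y : ℂ) * s‖ ≤ π * (1 - 1 / n) →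
      mellinK s y ≠ 0 ∧ (s ≠ 0 → ‖ratioK y s - (logScale y : ℂ)⁻¹ * zcoth (logScale y * s)‖ ≤
        C / (n * logScale y)) := by
  obtain ⟨ε, hε, C, hC, hb⟩ := exists_evenHalf_oddHalf_bound
  set C' := 2 * (C * (π ^ 2 + 2)) with hC'
  have hC'0 : 0 < C' := by positivity
  have hpi := Real.pi_pos
  -- Beyond `N₁` and `N₂` the points `s` and `y` lie in the range of `exists_evenHalf_oddHalf_bound`;
  -- beyond `N₃` the term with `cosh` is at most half of the lower bound for `sinh`.
  obtain ⟨N₁, hN₁⟩ := exists_nat_ge (π / (δ * ε))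
  obtain ⟨N₂, hN₂⟩ := exists_nat_ge (2 / (δ ^ 2 * ε))
  obtain ⟨N₃, hN₃⟩ := exists_nat_ge (C' * Real.exp π * π / δ ^ 3)
  refine ⟨C' * π ^ 2 / δ ^ 3, by positivity, 2 + N₁ + N₂ + N₃, by omega, fun n hn y hy hLn s hz => ?_⟩
  set l := logScale y with hl
  have hn2 : (2 : ℝ) ≤ n := by exact_mod_cast (show 2 ≤ n by omega)
  have hnN₁ : (N₁ : ℝ) ≤ n := by exact_mod_cast (show N₁ ≤ n by omega)
  have hnN₂ : (N₂ : ℝ) ≤ n := by exact_mod_cast (show N₂ ≤ n by omega)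
  have hnN₃ : (N₃ : ℝ) ≤ n := by exact_mod_cast (show N₃ ≤ n by omega)
  have hn0 : (0 : ℝ) < n := by linarith
  have hl0 : 0 < l := lt_of_lt_of_le (by positivity) hLn
  rcases eq_or_ne s 0 with rfl | hs0
  · refine ⟨?_, fun h => absurd rfl h⟩
    rw [← Complex.ofReal_zero, mellinK_ofReal]
    exact_mod_cast (mellinR_pos hy 0).ne'
  have hs_pos : 0 < ‖s‖ := norm_pos_iff.2 hs0
  have hnz : ‖(l : ℂ) * s‖ = l * ‖s‖ := by
    rw [norm_mul, Complex.norm_real, Real.norm_of_nonneg hl0.le]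
  have hzpi : l * ‖s‖ ≤ π := by
    rw [← hnz]
    refine hz.trans ?_
    have : 0 < 1 / (n : ℝ) := by positivity
    nlinarith
  have hsl : ‖s‖ ≤ π / l := by rw [le_div_iff₀ hl0]; linarith
  have hsε : ‖s‖ ≤ ε := by
    refine hsl.trans ?_
    calc π / l ≤ π / (δ * n) := by gcongr
      _ ≤ ε := by
        rw [div_le_iff₀ (by positivity)]
        have := hN₁.trans hnN₁
        rw [div_le_iff₀ (by positivity)] at this
        linarith
  have hy2 := le_two_div_logScale_sq hy hl0
  rw [← hl] at hy2
  have hyε : y ≤ ε := by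
    refine hy2.trans ?_
    calc 2 / l ^ 2 ≤ 2 / (δ * n) ^ 2 := by gcongr
      _ ≤ ε := by
        rw [div_le_iff₀ (by positivity)]
        have := hN₂.trans hnN₂
        rw [div_le_iff₀ (by positivity)] at this
        have h2 : (n : ℝ) * (δ ^ 2 * ε) ≤ (n : ℝ) ^ 2 * (δ ^ 2 * ε) := by
          gcongr
          nlinarith
        linarith
  obtain ⟨hE, hO⟩ := hb y hy hyε s hsε
  set E := evenHalf (normMellinK y) s with hEdef
  set O := oddHalf (normMellinK y) s with hOdef
  have hE0 : E ≠ 0 := norm_pos_iff.1 (by linarith)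
  set t := O / E with ht
  have htE : O = t * E := by rw [ht]; field_simp
  have hO' : ‖O‖ ≤ C * (π ^ 2 + 2) * ‖s‖ / l ^ 2 := by
    refine hO.trans ?_
    have : ‖s‖ ^ 2 + y ≤ (π ^ 2 + 2) / l ^ 2 := by
      rw [add_div, ← div_pow]
      gcongr
    calc C * ‖s‖ * (‖s‖ ^ 2 + y) ≤ C * ‖s‖ * ((π ^ 2 + 2) / l ^ 2) := by gcongr
      _ = _ := by ring
  have htn : ‖t‖ ≤ C' * ‖s‖ / l ^ 2 := by
    rw [ht, norm_div, div_le_iff₀ (by linarith)]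
    refine hO'.trans ?_
    have : 0 ≤ C' * ‖s‖ / l ^ 2 := by positivity
    calc C * (π ^ 2 + 2) * ‖s‖ / l ^ 2 = C' * ‖s‖ / l ^ 2 * (1 / 2) := by rw [hC']; ring
      _ ≤ _ := by gcongr
  set z : ℂ := (l : ℂ) * s with hzdef
  have hz_pos : 0 < ‖z‖ := by rw [hnz]; positivity
  have hsinh := le_norm_sinh (n := (n : ℝ)) (by linarith) ((Complex.abs_im_le_norm z).trans hz)
  have hcosh : ‖t * Complex.cosh z‖ ≤ 1 / (π * n) * ‖z‖ := by
    rw [norm_mul]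
    have h1 : ‖Complex.cosh z‖ ≤ Real.exp π :=
      (norm_cosh_le_exp z).trans (Real.exp_le_exp.2 (by rw [hnz]; exact hzpi))
    have h2 : C' * Real.exp π * (π * n) ≤ l ^ 3 := by
      have h3 := hN₃.trans hnN₃
      rw [div_le_iff₀ (by positivity)] at h3
      calc C' * Real.exp π * (π * n) = C' * Real.exp π * π * n := by ring
        _ ≤ (n * δ ^ 3) * n := by gcongr
        _ ≤ (n * δ ^ 3) * n ^ 2 := by
            gcongr
            nlinarith
        _ = (δ * n) ^ 3 := by ring
        _ ≤ l ^ 3 := by gcongr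
    calc ‖t‖ * ‖Complex.cosh z‖ ≤ C' * ‖s‖ / l ^ 2 * Real.exp π := by gcongr
      _ = C' * Real.exp π * (π * n) * (‖s‖ / (l ^ 2 * (π * n))) := by field_simp
      _ ≤ l ^ 3 * (‖s‖ / (l ^ 2 * (π * n))) := by gcongr
      _ = 1 / (π * n) * ‖z‖ := by rw [hnz]; field_simp
  have hden : 1 / (π * n) * ‖z‖ ≤ ‖Complex.sinh z + t * Complex.cosh z‖ := by
    have h1 := norm_sub_norm_le (Complex.sinh z) (-(t * Complex.cosh z))
    rw [sub_neg_eq_add, norm_neg] at h1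
    have : 2 / (π * n) * ‖z‖ = 2 * (1 / (π * n) * ‖z‖) := by ring
    linarith
  have hp1 : 0 < 2 / (π * n) * ‖z‖ := by positivity
  have hp2 : 0 < 1 / (π * n) * ‖z‖ := by positivity
  have hsinh0 : Complex.sinh z ≠ 0 := norm_pos_iff.1 (hp1.trans_le hsinh)
  have hden0 : Complex.sinh z + t * Complex.cosh z ≠ 0 := norm_pos_iff.1 (hp2.trans_le hden)
  obtain ⟨hM, heq⟩ := ratioK_sub_zcoth hy hs0 hl0.ne' hE0 htE hsinh0 hden0
  refine ⟨hM, fun _ => ?_⟩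
  rw [← hl, ← hzdef] at heq
  rw [heq, norm_div, norm_neg, norm_mul, norm_mul]
  calc ‖s‖ * ‖t‖ / (‖Complex.sinh z‖ * ‖Complex.sinh z + t * Complex.cosh z‖)
      ≤ ‖s‖ * (C' * ‖s‖ / l ^ 2) / ((2 / (π * n) * ‖z‖) * (1 / (π * n) * ‖z‖)) := by gcongr
    _ = C' * π ^ 2 * n ^ 2 / 2 / l ^ 4 := by
        rw [hnz]; field_simp
    _ ≤ C' * π ^ 2 * n ^ 2 / l ^ 4 := by
        gcongr
        linarith [show 0 < C' * π ^ 2 * (n : ℝ) ^ 2 by positivity]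
    _ = C' * π ^ 2 * n ^ 2 / (l ^ 3 * l) := by ring
    _ ≤ C' * π ^ 2 * n ^ 2 / ((δ * n) ^ 3 * l) := by gcongr
    _ = C' * π ^ 2 / δ ^ 3 / (n * l) := by field_simp

/-- Shrinking the radius of the Cauchy estimate by the factor `1 - 1 / n` costs only a constant. -/
theorem one_sub_inv_pow_ge {n : ℕ} (hn : 2 ≤ n) :
    Real.exp (-4) ≤ (1 - 1 / (n : ℝ)) ^ (2 * n) := by
  have hn2 : (2 : ℝ) ≤ n := by exact_mod_cast hn
  have h1 : 0 < 1 - 1 / (n : ℝ) := by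
    rw [sub_pos, div_lt_one (by linarith)]; linarith
  have h2 : Real.exp (-(1 / ((n : ℝ) - 1))) ≤ 1 - 1 / (n : ℝ) := by
    rw [Real.exp_neg]
    have h3 := Real.add_one_le_exp (1 / ((n : ℝ) - 1))
    have h4 : 1 - 1 / (n : ℝ) = (1 / ((n : ℝ) - 1) + 1)⁻¹ := by
      have : (n : ℝ) - 1 ≠ 0 := by linarith
      have hn0 : (n : ℝ) ≠ 0 := by linarith
      refine eq_inv_of_mul_eq_one_left ?_
      rw [div_add_one this, add_sub_cancel, one_sub_div hn0]
      field_simp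
    rw [h4]
    have : 0 < (n : ℝ) - 1 := by linarith
    gcongr
  refine le_trans ?_ (pow_le_pow_left₀ (Real.exp_pos _).le h2 _)
  rw [← Real.exp_nat_mul]
  gcongr
  push_cast
  have : 0 < (n : ℝ) - 1 := by linarith
  rw [mul_neg, neg_le_neg_iff, mul_one_div, div_le_iff₀ this]
  linarith

open Real in
/-- The even Taylor coefficients of the extended integrand agree with those of `s coth (s L)` up to
a relative error `O(1 / n)`, provided that `L` is at least of order `n`. -/
theorem exists_coeff_bound {δ : ℝ} (hδ : 0 < δ) : ∃ C > 0, ∃ N : ℕ, 2 ≤ N ∧ ∀ n : ℕ, N ≤ n →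
    ∀ y, 0 < y → δ * n ≤ logScale y →
      ‖iteratedDeriv (2 * n) (ratioK y) 0 / ((2 * n)! : ℂ) -
        (logScale y : ℂ) ^ (2 * n - 1) * (iteratedDeriv (2 * n) zcoth 0 / ((2 * n)! : ℂ))‖ ≤
        C / n * logScale y ^ (2 * n - 1) / π ^ (2 * n) := by
  obtain ⟨C, hC, N, hN, h⟩ := exists_ratioK_sub_zcoth_bound hδ
  refine ⟨C * Real.exp 4, by positivity, N, hN, fun n hn y hy hLn => ?_⟩
  have hpi := Real.pi_pos
  have hn2 : (2 : ℝ) ≤ n := by exact_mod_cast (hN.trans hn)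
  have hn0 : (0 : ℝ) < n := by linarith
  have hinv : 0 < 1 - 1 / (n : ℝ) := by
    rw [sub_pos, div_lt_one (by linarith)]; linarith
  have hinv1 : 1 - 1 / (n : ℝ) < 1 := by linarith [show 0 < 1 / (n : ℝ) by positivity]
  set l := logScale y with hl
  have hl0 : 0 < l := lt_of_lt_of_le (by positivity) hLn
  set R := π * (1 - 1 / n) / l with hR
  have hR0 : 0 < R := by positivity
  have hz : ∀ s : ℂ, ‖s‖ ≤ R → ‖(l : ℂ) * s‖ ≤ π * (1 - 1 / n) := by
    intro s hs
    rw [norm_mul, Complex.norm_real, Real.norm_of_nonneg hl0.le]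
    rw [hR, le_div_iff₀ hl0] at hs
    linarith
  have hdg : ∀ s : ℂ, ‖s‖ ≤ R → DifferentiableAt ℂ (ratioK y) s := fun s hs =>
    differentiableAt_ratioK hy (h n hn y hy hLn s (hz s hs)).1
  have hdc : ∀ s : ℂ, ‖s‖ ≤ R → DifferentiableAt ℂ (fun s => (l : ℂ)⁻¹ * zcoth (l * s)) s := by
    intro s hs
    have h1 : DifferentiableAt ℂ zcoth (l * s) := by
      refine differentiableAt_zcoth ((hz s hs).trans_lt ?_)
      exact mul_lt_of_lt_one_right hpi hinv1
    exact DifferentiableAt.const_mul (h1.comp (f := fun s : ℂ => (l : ℂ) * s) s (by fun_prop)) _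
  have hon1 : DifferentiableOn ℂ (ratioK y) (Metric.closedBall 0 R) := fun s hs =>
    (hdg s (by simpa using hs)).differentiableWithinAt
  have hon2 : DifferentiableOn ℂ (fun s => (l : ℂ)⁻¹ * zcoth (l * s)) (Metric.closedBall 0 R) :=
    fun s hs => (hdc s (by simpa using hs)).differentiableWithinAt
  have key := Complex.norm_iteratedDeriv_le_of_forall_mem_sphere_norm_le (2 * n) hR0
    ((hon1.sub hon2).diffContOnCl_ball le_rfl) (C := C / (n * l)) (fun s hs => by
      rw [mem_sphere_zero_iff_norm] at hs
      refine (h n hn y hy hLn s (hz s hs.le)).2 ?_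
      rw [← norm_pos_iff, hs]; exact hR0)
  have hnhds := Metric.closedBall_mem_nhds (0 : ℂ) hR0
  rw [iteratedDeriv_sub (hon1.analyticAt hnhds).contDiffAt (hon2.analyticAt hnhds).contDiffAt,
    iteratedDeriv_const_mul_field, iteratedDeriv_comp_mul_left] at key
  simp only [mul_zero, smul_eq_mul] at key
  have hf : (0 : ℝ) < ((2 * n)! : ℝ) := by exact_mod_cast Nat.factorial_pos _
  have hlC : (l : ℂ) ≠ 0 := by exact_mod_cast hl0.ne'
  have hpow : (l : ℂ)⁻¹ * ((l : ℂ) ^ (2 * n) * iteratedDeriv (2 * n) zcoth 0) =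
      (l : ℂ) ^ (2 * n - 1) * iteratedDeriv (2 * n) zcoth 0 := by
    rw [← mul_assoc, ← pow_sub_one_mul (show 2 * n ≠ 0 by have := hN.trans hn; omega) (l : ℂ)]
    field_simp
  rw [hpow] at key
  rw [← mul_div_assoc, ← sub_div, norm_div, Complex.norm_natCast, div_le_iff₀ hf]
  refine key.trans ?_
  have hq := one_sub_inv_pow_ge (hN.trans hn)
  rw [Real.exp_neg] at hq
  have hlpow : l ^ (2 * n) = l ^ (2 * n - 1) * l :=
    (pow_sub_one_mul (show 2 * n ≠ 0 by have := hN.trans hn; omega) l).symm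
  rw [hR, div_pow, mul_pow]
  calc ((2 * n)! : ℝ) * (C / (n * l)) / (π ^ (2 * n) * (1 - 1 / n) ^ (2 * n) / l ^ (2 * n))
      ≤ ((2 * n)! : ℝ) * (C / (n * l)) / (π ^ (2 * n) * (Real.exp 4)⁻¹ / l ^ (2 * n)) := by
        gcongr
    _ = _ := by
        rw [hlpow]
        field_simp

/-! ### Asymptotics of the Taylor coefficients -/

/-- Negligibility of the range where the logarithmic scale is less than a small multiple of `n`. -/
theorem tendsto_mul_pow_div_factorial {θ : ℝ} (h0 : 0 ≤ θ) (h1 : θ ≤ 1 / 4) :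
    Tendsto (fun n : ℕ => (θ * n) ^ (2 * n) / ((2 * n - 1)! : ℝ)) atTop (𝓝 0) := by
  have hlim : Tendsto (fun n : ℕ => 2 * ((n : ℝ) * (1 / 4 : ℝ) ^ n)) atTop (𝓝 0) := by
    simpa using (tendsto_self_mul_const_pow_of_lt_one (r := (1 / 4 : ℝ)) (by norm_num)
      (by norm_num)).const_mul 2
  refine squeeze_zero' (Eventually.of_forall fun n => by positivity) ?_ hlim
  filter_upwards [eventually_ge_atTop 1] with n hn
  have hf : (0 : ℝ) < ((2 * n - 1)! : ℝ) := by exact_mod_cast Nat.factorial_pos _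
  have hfac : ((2 * n)! : ℝ) = 2 * n * ((2 * n - 1)! : ℝ) := by
    rw [← Nat.mul_factorial_pred (show 2 * n ≠ 0 by omega)]
    push_cast; ring
  have he := Real.pow_div_factorial_le_exp (2 * (n : ℝ)) (by positivity) (2 * n)
  have hn0 : (0 : ℝ) < n := by exact_mod_cast hn
  rw [hfac, div_le_iff₀ (by positivity)] at he
  rw [div_le_iff₀ hf]
  have hexp : Real.exp (2 * (n : ℝ)) = (Real.exp 1 ^ 2) ^ n := by
    rw [← pow_mul, ← Real.exp_nat_mul]; push_cast; ring_nf
  have hb : (1 / 8 : ℝ) ^ 2 * Real.exp 1 ^ 2 ≤ 1 / 4 := by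
    have h3 := Real.exp_one_lt_d9
    have h4 := Real.exp_pos 1
    nlinarith
  calc (θ * n) ^ (2 * n) ≤ (1 / 4 * n) ^ (2 * n) := by gcongr
    _ = ((1 / 8) ^ 2) ^ n * (2 * n) ^ (2 * n) := by
        rw [← pow_mul, ← mul_pow]; ring_nf
    _ ≤ ((1 / 8) ^ 2) ^ n * ((Real.exp 1 ^ 2) ^ n * (2 * n * ((2 * n - 1)! : ℝ))) := by
        rw [← hexp]; gcongr
    _ = ((1 / 8) ^ 2 * Real.exp 1 ^ 2) ^ n * (2 * n * ((2 * n - 1)! : ℝ)) := by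
        rw [mul_pow]; ring
    _ ≤ (1 / 4) ^ n * (2 * n * ((2 * n - 1)! : ℝ)) := by gcongr
    _ = _ := by ring

/-- The substitution `l = log (2 / x) - γ` in the moments of the logarithmic scale. -/
theorem integral_logScale_pow (m : ℕ) {d : ℝ} (hd : 0 < d) :
    IntegrableOn (fun x => logScale (x / 2) ^ m) (Ioc 0 (2 * Real.exp (-γ - d))) ∧
    ∫ x in Ioc 0 (2 * Real.exp (-γ - d)), logScale (x / 2) ^ m =
      2 * Real.exp (-γ) * ∫ l in Ici d, Real.exp (-l) * l ^ m := by
  have himg : (fun l : ℝ => 2 * Real.exp (-γ - l)) '' Ici d = Ioc 0 (2 * Real.exp (-γ - d)) := by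
    ext x
    simp only [mem_image, mem_Ici, mem_Ioc]
    constructor
    · rintro ⟨l, hl, rfl⟩
      exact ⟨by positivity, by gcongr⟩
    · rintro ⟨h1, h2⟩
      refine ⟨-γ - Real.log (x / 2), ?_, ?_⟩
      · have h3 : x / 2 ≤ Real.exp (-γ - d) := by linarith
        have := (Real.log_le_iff_le_exp (by positivity)).2 h3
        linarith
      · rw [sub_sub_cancel, Real.exp_log (by positivity)]
        ring
  have hder : ∀ l ∈ Ici d, HasDerivWithinAt (fun l : ℝ => 2 * Real.exp (-γ - l))
      (-(2 * Real.exp (-γ - l))) (Ici d) l := by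
    intro l _
    have := (((hasDerivAt_id l).const_sub (-γ)).exp).const_mul 2
    refine (this.congr_deriv ?_).hasDerivWithinAt
    simp
  have hinj : InjOn (fun l : ℝ => 2 * Real.exp (-γ - l)) (Ici d) := by
    intro a _ b _ h
    have h2 : -γ - a = -γ - b := Real.exp_injective (mul_left_cancel₀ two_ne_zero h)
    linarith
  have hfun : ∀ l : ℝ, |(-(2 * Real.exp (-γ - l)))| • logScale (2 * Real.exp (-γ - l) / 2) ^ m =
      2 * Real.exp (-γ) * (Real.exp (-l) * l ^ m) := by
    intro l
    rw [abs_neg, abs_of_pos (by positivity), mul_div_cancel_left₀ _ two_ne_zero, logScale,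
      Real.log_exp, smul_eq_mul, sub_eq_add_neg (-γ), Real.exp_add]
    ring_nf
  have hint : IntegrableOn (fun l : ℝ => Real.exp (-l) * l ^ m) (Ici d) := by
    have h := Real.GammaIntegral_convergent (s := (m : ℝ) + 1) (by positivity)
    simp only [add_sub_cancel_right, Real.rpow_natCast] at h
    exact h.mono_set fun l hl => lt_of_lt_of_le hd hl
  constructor
  · rw [← himg, integrableOn_image_iff_integrableOn_abs_deriv_smul measurableSet_Ici hder hinj]
    simp_rw [hfun]
    exact hint.const_mul _
  · rw [← himg, integral_image_eq_integral_abs_deriv_smul measurableSet_Ici hder hinj]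
    simp_rw [hfun]
    rw [integral_const_mul]

theorem integral_exp_neg_mul_pow_bounds (m : ℕ) {d : ℝ} (hd : 0 < d) :
    (m ! : ℝ) - d ^ (m + 1) ≤ ∫ l in Ici d, Real.exp (-l) * l ^ m ∧
    ∫ l in Ici d, Real.exp (-l) * l ^ m ≤ (m ! : ℝ) := by
  have hint := Real.GammaIntegral_convergent (s := (m : ℝ) + 1) (by positivity)
  have hG := Real.Gamma_eq_integral (s := (m : ℝ) + 1) (by positivity)
  simp only [add_sub_cancel_right, Real.rpow_natCast] at hint hG
  have hdisj : Disjoint (Ioo 0 d) (Ici d) :=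
    Set.disjoint_left.2 fun x hx hx' => absurd hx.2 (not_lt.2 hx')
  rw [Real.Gamma_nat_eq_factorial, ← Ioo_union_Ici_eq_Ioi hd, setIntegral_union hdisj
    measurableSet_Ici (hint.mono_set Ioo_subset_Ioi_self)
    (hint.mono_set fun l hl => lt_of_lt_of_le hd hl)] at hG
  have h0 : 0 ≤ ∫ l in Ioo 0 d, Real.exp (-l) * l ^ m :=
    setIntegral_nonneg measurableSet_Ioo fun l hl => by have := hl.1; positivity
  have h1 : ∫ l in Ioo 0 d, Real.exp (-l) * l ^ m ≤ d ^ (m + 1) := by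
    have h2 := norm_setIntegral_le_of_norm_le_const (μ := volume) (s := Ioo 0 d)
      (f := fun l : ℝ => Real.exp (-l) * l ^ m) (C := d ^ m) (by simp) fun l hl => by
        have hl0 := hl.1
        rw [Real.norm_of_nonneg (by positivity)]
        calc Real.exp (-l) * l ^ m ≤ 1 * d ^ m := by
              gcongr
              · exact Real.exp_le_one_iff.2 (by linarith)
              · exact hl.2.le
          _ = d ^ m := one_mul _
    rw [Real.norm_of_nonneg h0] at h2
    refine h2.trans (le_of_eq ?_)
    simp [hd.le, pow_succ]
  constructor <;> linarith

/-- The integrated even Taylor coefficients, normalised by their expected size. -/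
theorem tendsto_normalized_coeff {η : ℝ} (hη : 0 < η) :
    Tendsto (fun n : ℕ => (-1 : ℂ) ^ (n + 1) * (Real.pi : ℂ) ^ (2 * n) / ((2 * n - 1)! : ℂ) *
      ∫ x in Ioo 0 η, iteratedDeriv (2 * n) (ratioK (x / 2)) 0 / ((2 * n)! : ℂ)) atTop
      (𝓝 ((4 * Real.exp (-γ) : ℝ) : ℂ)) := by
  have hpi := Real.pi_pos
  have hγ : 0 < γ := lt_trans (by norm_num) Real.one_half_lt_eulerMascheroniConstant
  obtain ⟨ρ, hρ, C₂, hC₂, hcrude⟩ := exists_iteratedDeriv_bound (η / 2)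
  -- The threshold `δ n` for the logarithmic scale is small enough for the crude bound to be
  -- negligible where the scale is below it.
  set δ : ℝ := min (1 / 4) (ρ / (8 * Real.pi)) with hδ
  have hδ0 : 0 < δ := by positivity
  have hδ1 : δ ≤ 1 / 4 := min_le_left _ _
  have hδ2 : 2 * δ * Real.pi / ρ ≤ 1 / 4 := by
    have : δ ≤ ρ / (8 * Real.pi) := min_le_right _ _
    rw [le_div_iff₀ (by positivity)] at this
    rw [div_le_iff₀ hρ]
    linarith
  obtain ⟨C₁, hC₁, N, hN, hfine⟩ := exists_coeff_bound hδ0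
  set X : ℕ → ℝ := fun n => 2 * Real.exp (-γ - δ * n) with hX
  set κ : ℕ → ℂ := fun n => iteratedDeriv (2 * n) zcoth 0 / ((2 * n)! : ℂ) with hκ
  set J : ℕ → ℝ := fun n => ∫ x in Ioc 0 (X n), logScale (x / 2) ^ (2 * n - 1) with hJ
  set A : ℕ → ℝ → ℂ := fun n x => iteratedDeriv (2 * n) (ratioK (x / 2)) 0 / ((2 * n)! : ℂ) with hA
  have hAint : ∀ n, IntegrableOn (A n) (Ioo 0 η) := by
    intro n
    have := (evenF_chain hη (2 * n) (a := 0) (by constructor <;> norm_num)).1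
    rw [Complex.ofReal_zero] at this
    exact this.div_const _
  have hJb : ∀ n : ℕ, 1 ≤ n →
      2 * Real.exp (-γ) * (1 - (δ * n) ^ (2 * n) / ((2 * n - 1)! : ℝ)) ≤ J n / ((2 * n - 1)! : ℝ) ∧
      J n ≤ 2 * Real.exp (-γ) * ((2 * n - 1)! : ℝ) := by
    intro n hn
    have hn0 : (0 : ℝ) < n := by exact_mod_cast hn
    have hf : (0 : ℝ) < ((2 * n - 1)! : ℝ) := by exact_mod_cast Nat.factorial_pos _
    have h1 := (integral_logScale_pow (2 * n - 1) (show 0 < δ * n by positivity)).2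
    have h2 := integral_exp_neg_mul_pow_bounds (2 * n - 1) (show 0 < δ * n by positivity)
    rw [show 2 * n - 1 + 1 = 2 * n by omega] at h2
    simp only [hJ, hX]
    rw [h1]
    constructor
    · rw [le_div_iff₀ hf, mul_assoc, sub_mul, one_mul, div_mul_cancel₀ _ hf.ne']
      exact mul_le_mul_of_nonneg_left h2.1 (by positivity)
    · exact mul_le_mul_of_nonneg_left h2.2 (by positivity)
  have hJlim : Tendsto (fun n : ℕ => J n / ((2 * n - 1)! : ℝ)) atTop (𝓝 (2 * Real.exp (-γ))) := by
    have hlow : Tendsto (fun n : ℕ => 2 * Real.exp (-γ) *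
        (1 - (δ * n) ^ (2 * n) / ((2 * n - 1)! : ℝ))) atTop (𝓝 (2 * Real.exp (-γ))) := by
      simpa using ((tendsto_mul_pow_div_factorial hδ0.le hδ1).const_sub 1).const_mul
        (2 * Real.exp (-γ))
    refine tendsto_of_tendsto_of_tendsto_of_le_of_le' hlow tendsto_const_nhds ?_ ?_
    · filter_upwards [eventually_ge_atTop 1] with n hn using (hJb n hn).1
    · filter_upwards [eventually_ge_atTop 1] with n hn
      have hf : (0 : ℝ) < ((2 * n - 1)! : ℝ) := by exact_mod_cast Nat.factorial_pos _
      rw [div_le_iff₀ hf]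
      exact (hJb n hn).2
  have hmain : Tendsto (fun n : ℕ => ((-1 : ℂ) ^ (n + 1) * (Real.pi : ℂ) ^ (2 * n) * κ n) *
      ((J n / ((2 * n - 1)! : ℝ) : ℝ) : ℂ)) atTop (𝓝 ((4 * Real.exp (-γ) : ℝ) : ℂ)) := by
    have h := tendsto_zcoth_coeff.mul
      ((Complex.continuous_ofReal.tendsto _).comp hJlim)
    have e : (2 : ℂ) * ((2 * Real.exp (-γ) : ℝ) : ℂ) = ((4 * Real.exp (-γ) : ℝ) : ℂ) := by
      push_cast; ring
    rw [e] at h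
    exact h
  have herr : Tendsto (fun n : ℕ => 2 * C₁ * Real.exp (-γ) * (1 / (n : ℝ)) +
      C₂ * η * ((2 * δ * Real.pi / ρ * n) ^ (2 * n) / ((2 * n - 1)! : ℝ))) atTop (𝓝 0) := by
    simpa using (tendsto_one_div_atTop_nhds_zero_nat.const_mul (2 * C₁ * Real.exp (-γ))).add
      ((tendsto_mul_pow_div_factorial (by positivity) hδ2).const_mul (C₂ * η))
  have hXlim : ∀ᶠ n : ℕ in atTop, X n < η := by
    have h1 : Tendsto (fun n : ℕ => -γ - δ * (n : ℝ)) atTop atBot := by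
      have h2 : Tendsto (fun n : ℕ => δ * (n : ℝ)) atTop atTop :=
        tendsto_natCast_atTop_atTop.const_mul_atTop hδ0
      simpa [sub_eq_add_neg] using tendsto_atBot_add_const_left atTop (-γ)
        (tendsto_neg_atTop_atBot.comp h2)
    have h3 : Tendsto X atTop (𝓝 0) := by
      simpa using (Real.tendsto_exp_atBot.comp h1).const_mul 2
    exact h3.eventually (gt_mem_nhds hη)
  have hlarge : ∀ᶠ n : ℕ in atTop, 1 + γ + |Real.log (η / 2)| ≤ δ * n :=
    (tendsto_natCast_atTop_atTop.const_mul_atTop hδ0).eventually_ge_atTop _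
  have hdiff : ∀ᶠ n : ℕ in atTop,
      ‖(-1 : ℂ) ^ (n + 1) * (Real.pi : ℂ) ^ (2 * n) / ((2 * n - 1)! : ℂ) * (∫ x in Ioo 0 η, A n x) -
        ((-1 : ℂ) ^ (n + 1) * (Real.pi : ℂ) ^ (2 * n) * κ n) * ((J n / ((2 * n - 1)! : ℝ) : ℝ) : ℂ)‖
      ≤ 2 * C₁ * Real.exp (-γ) * (1 / (n : ℝ)) +
        C₂ * η * ((2 * δ * Real.pi / ρ * n) ^ (2 * n) / ((2 * n - 1)! : ℝ)) := by
    filter_upwards [hXlim, hlarge, eventually_ge_atTop N] with n hXn hln hNn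
    have hn1 : 1 ≤ n := by omega
    have hn0 : (0 : ℝ) < n := by exact_mod_cast hn1
    have hf : (0 : ℝ) < ((2 * n - 1)! : ℝ) := by exact_mod_cast Nat.factorial_pos _
    have hf2 : (0 : ℝ) < ((2 * n)! : ℝ) := by exact_mod_cast Nat.factorial_pos _
    have hX0 : 0 < X n := by simp only [hX]; positivity
    have hsub : Ioc 0 (X n) ⊆ Ioo 0 η := fun x hx => ⟨hx.1, hx.2.trans_lt hXn⟩
    have hsub2 : Ioo (X n) η ⊆ Ioo 0 η := fun x hx => ⟨hX0.trans hx.1, hx.2⟩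
    have hLint : IntegrableOn (fun x => logScale (x / 2) ^ (2 * n - 1)) (Ioc 0 (X n)) :=
      (integral_logScale_pow (2 * n - 1) (show 0 < δ * n by positivity)).1
    have hLintC : IntegrableOn (fun x => (logScale (x / 2) : ℂ) ^ (2 * n - 1) * κ n)
        (Ioc 0 (X n)) := by
      have h : IntegrableOn (fun x => ((logScale (x / 2) ^ (2 * n - 1) : ℝ) : ℂ)) (Ioc 0 (X n)) :=
        hLint.ofReal
      simp only [Complex.ofReal_pow] at h
      exact h.mul_const _
    have hJC : (J n : ℂ) * κ n =
        ∫ x in Ioc 0 (X n), (logScale (x / 2) : ℂ) ^ (2 * n - 1) * κ n := by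
      rw [integral_mul_const]
      simp only [hJ]
      rw [← integral_complex_ofReal]
      simp only [Complex.ofReal_pow]
    have hsplit : ∫ x in Ioo 0 η, A n x =
        (∫ x in Ioc 0 (X n), A n x) + ∫ x in Ioo (X n) η, A n x := by
      rw [← Ioc_union_Ioo_eq_Ioo hX0.le hXn, setIntegral_union ?_ measurableSet_Ioo
        ((hAint n).mono_set hsub) ((hAint n).mono_set hsub2)]
      rw [Set.disjoint_left]
      exact fun x hx hx' => absurd hx.2 (not_le.2 hx'.1)
    have hsmall : ‖(∫ x in Ioc 0 (X n), A n x) - (J n : ℂ) * κ n‖ ≤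
        C₁ / n / Real.pi ^ (2 * n) * J n := by
      rw [hJC, ← integral_sub ((hAint n).mono_set hsub) hLintC]
      simp only [hJ]
      rw [← integral_const_mul]
      refine norm_integral_le_of_norm_le (hLint.const_mul _) ?_
      filter_upwards [self_mem_ae_restrict measurableSet_Ioc] with x hx
      have hx0 : 0 < x / 2 := by linarith [hx.1]
      refine (hfine n hNn (x / 2) hx0 ?_).trans (le_of_eq (by ring))
      have h3 : x / 2 ≤ Real.exp (-γ - δ * n) := by
        have := hx.2
        simp only [hX] at this
        linarith
      have := (Real.log_le_iff_le_exp hx0).2 h3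
      rw [logScale]
      linarith
    have hrest : ‖∫ x in Ioo (X n) η, A n x‖ ≤ C₂ / ρ ^ (2 * n) * (2 * δ * n) ^ (2 * n) * η := by
      have h := norm_setIntegral_le_of_norm_le_const (μ := volume) (s := Ioo (X n) η)
        (f := A n) (C := C₂ / ρ ^ (2 * n) * (2 * δ * n) ^ (2 * n)) (by simp) fun x hx => by
          have hx0 : 0 < x / 2 := by linarith [hx.1]
          have h1 := (hcrude (x / 2) hx0 (by linarith [hx.2]) 0 (by constructor <;> norm_num)).2
            (2 * n)
          rw [Complex.ofReal_zero] at h1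
          have h2 : 1 + |Real.log (x / 2)| ≤ 2 * δ * n := by
            have e1 : -γ - δ * n ≤ Real.log (x / 2) := by
              rw [Real.le_log_iff_exp_le hx0]
              have := hx.1
              simp only [hX] at this
              linarith
            have e2 : Real.log (x / 2) ≤ |Real.log (η / 2)| :=
              (Real.log_le_log hx0 (by linarith [hx.2])).trans (le_abs_self _)
            have e3 := abs_nonneg (Real.log (η / 2))
            have e4 : |Real.log (x / 2)| ≤ γ + δ * n + |Real.log (η / 2)| := by
              rw [abs_le]; constructor <;> nlinarith
            linarith
          simp only [hA]
          rw [norm_div, Complex.norm_natCast, div_le_iff₀ hf2]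
          refine h1.trans ?_
          calc ((2 * n)! : ℝ) * C₂ / ρ ^ (2 * n) * (1 + |Real.log (x / 2)|) ^ (2 * n)
              ≤ ((2 * n)! : ℝ) * C₂ / ρ ^ (2 * n) * (2 * δ * n) ^ (2 * n) := by gcongr
            _ = _ := by ring
      refine h.trans ?_
      gcongr
      rw [Real.volume_real_Ioo_of_le hXn.le]
      linarith
    have hfC : ((2 * n - 1)! : ℂ) ≠ 0 := by exact_mod_cast (Nat.factorial_pos _).ne'
    have e : (-1 : ℂ) ^ (n + 1) * (Real.pi : ℂ) ^ (2 * n) / ((2 * n - 1)! : ℂ) *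
          (∫ x in Ioo 0 η, A n x) -
        ((-1 : ℂ) ^ (n + 1) * (Real.pi : ℂ) ^ (2 * n) * κ n) *
          ((J n / ((2 * n - 1)! : ℝ) : ℝ) : ℂ) =
        (-1 : ℂ) ^ (n + 1) * (Real.pi : ℂ) ^ (2 * n) / ((2 * n - 1)! : ℂ) *
          (((∫ x in Ioc 0 (X n), A n x) - (J n : ℂ) * κ n) + ∫ x in Ioo (X n) η, A n x) := by
      rw [hsplit]
      push_cast
      ring
    rw [e, norm_mul, norm_div, norm_mul, norm_pow, norm_neg, norm_one, one_pow, one_mul, norm_pow,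
      Complex.norm_real, Real.norm_of_nonneg hpi.le, Complex.norm_natCast]
    calc Real.pi ^ (2 * n) / ((2 * n - 1)! : ℝ) *
        ‖((∫ x in Ioc 0 (X n), A n x) - (J n : ℂ) * κ n) + ∫ x in Ioo (X n) η, A n x‖
        ≤ Real.pi ^ (2 * n) / ((2 * n - 1)! : ℝ) *
          (C₁ / n / Real.pi ^ (2 * n) * (2 * Real.exp (-γ) * ((2 * n - 1)! : ℝ)) +
            C₂ / ρ ^ (2 * n) * (2 * δ * n) ^ (2 * n) * η) := by
          gcongr
          refine (norm_add_le _ _).trans (add_le_add (hsmall.trans ?_) hrest)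
          gcongr
          exact (hJb n hn1).2
      _ = _ := by
          rw [show 2 * δ * Real.pi / ρ * n = Real.pi / ρ * (2 * δ * n) by ring, mul_pow _ (2 * δ * n),
            div_pow]
          field_simp
  have hzero := squeeze_zero_norm' hdiff herr
  simpa using hzero.add hmain

/-- The asymptotics of the even Taylor coefficients of `F` at `0`. -/
theorem taylorCoeff_even_isEquivalent {η : ℝ} (hη : 0 < η) :
    (fun n : ℕ => taylorCoeff (F η) (2 * n)) ~[atTop]
      (fun n : ℕ => 4 * Real.exp (-γ) * (-1 : ℝ) ^ (n + 1) *
        ((2 * n - 1)! : ℝ) / Real.pi ^ (2 * n)) := by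
  have hpi := Real.pi_pos
  have hne : ∀ n : ℕ, 4 * Real.exp (-γ) * (-1 : ℝ) ^ (n + 1) *
      ((2 * n - 1)! : ℝ) / Real.pi ^ (2 * n) ≠ 0 := by
    intro n
    have hf : ((2 * n - 1)! : ℝ) ≠ 0 := by exact_mod_cast (Nat.factorial_pos _).ne'
    have := Real.exp_pos (-γ)
    have h1 : (-1 : ℝ) ^ (n + 1) ≠ 0 := pow_ne_zero _ (by norm_num)
    positivity
  rw [isEquivalent_iff_tendsto_one (Eventually.of_forall hne)]
  have h := (Complex.continuous_re.tendsto _).comp (tendsto_normalized_coeff hη)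
  rw [Complex.ofReal_re] at h
  have h2 := h.div_const (4 * Real.exp (-γ))
  rw [div_self (by positivity)] at h2
  refine h2.congr fun n => ?_
  have hf : (0 : ℝ) < ((2 * n - 1)! : ℝ) := by exact_mod_cast Nat.factorial_pos _
  have hcoeff : taylorCoeff (F η) (2 * n) =
      (∫ x in Ioo 0 η, iteratedDeriv (2 * n) (ratioK (x / 2)) 0 / ((2 * n)! : ℂ)).re := by
    rw [taylorCoeff, iteratedDeriv_F hη, if_neg (by omega), sub_zero, iteratedDeriv_evenF hη,
      integral_div, ← Complex.ofReal_natCast, Complex.div_ofReal_re]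
  have hreal : (-1 : ℂ) ^ (n + 1) * (Real.pi : ℂ) ^ (2 * n) / ((2 * n - 1)! : ℂ) =
      (((-1 : ℝ) ^ (n + 1) * Real.pi ^ (2 * n) / ((2 * n - 1)! : ℝ) : ℝ) : ℂ) := by
    push_cast; rfl
  simp only [Function.comp_apply, Pi.div_apply]
  rw [hreal, Complex.re_ofReal_mul, ← hcoeff]
  have hs : ((-1 : ℝ) ^ (n + 1)) * (-1) ^ (n + 1) = 1 := by
    rw [← mul_pow]; norm_num
  have hs0 : (-1 : ℝ) ^ (n + 1) ≠ 0 := pow_ne_zero _ (by norm_num)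
  have he := (Real.exp_pos (-γ)).ne'
  rw [div_eq_div_iff (by positivity) (hne n)]
  field_simp
  linear_combination (taylorCoeff (F η) (2 * n)) * hs

theorem radius_taylorSeries_eq_zero {η : ℝ} (hη : 0 < η) :
    (FormalMultilinearSeries.ofScalars ℝ (taylorCoeff (F η))).radius = 0 := by
  by_contra hne
  obtain ⟨r, hr0, hr⟩ := ENNReal.lt_iff_exists_nnreal_btwn.1 (pos_iff_ne_zero.2 hne)
  obtain ⟨C, hC, hb⟩ := FormalMultilinearSeries.norm_mul_pow_le_of_lt_radius _ hr
  have hr0' : (0 : ℝ) < r := by exact_mod_cast hr0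
  have hpi := Real.pi_pos
  set c : ℝ := 4 * Real.exp (-γ) with hc
  have hc0 : 0 < c := by positivity
  -- The equivalence gives `|c₂ₙ| ≥ (c / 2) (2n-1)! / π^(2n)` for large `n`.
  have hlow : ∀ᶠ n : ℕ in atTop, c / 2 * ((2 * n - 1)! : ℝ) / Real.pi ^ (2 * n) ≤
      ‖taylorCoeff (F η) (2 * n)‖ := by
    have h := (taylorCoeff_even_isEquivalent hη).isLittleO.def (c := 1 / 2) (by norm_num)
    filter_upwards [h] with n hn
    have hv : ‖4 * Real.exp (-γ) * (-1 : ℝ) ^ (n + 1) * ((2 * n - 1)! : ℝ) / Real.pi ^ (2 * n)‖ =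
        c * ((2 * n - 1)! : ℝ) / Real.pi ^ (2 * n) := by
      rw [norm_div, norm_mul, norm_mul, norm_pow, norm_pow, norm_neg, norm_one, one_pow, mul_one,
        Real.norm_of_nonneg hc0.le, Real.norm_natCast, Real.norm_of_nonneg hpi.le]
    simp only [Pi.sub_apply] at hn
    rw [hv] at hn
    have h1 := norm_sub_norm_le (4 * Real.exp (-γ) * (-1 : ℝ) ^ (n + 1) *
      ((2 * n - 1)! : ℝ) / Real.pi ^ (2 * n)) (taylorCoeff (F η) (2 * n))
    rw [norm_sub_rev, hv] at h1
    have h2 : c / 2 * ((2 * n - 1)! : ℝ) / Real.pi ^ (2 * n) =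
      c * ((2 * n - 1)! : ℝ) / Real.pi ^ (2 * n) -
        1 / 2 * (c * ((2 * n - 1)! : ℝ) / Real.pi ^ (2 * n)) := by ring
    linarith
  have hlim : Tendsto (fun n : ℕ => Real.pi / r * ((Real.pi / r) ^ (2 * n - 1) /
      ((2 * n - 1)! : ℝ))) atTop (𝓝 0) := by
    have h1 : Tendsto (fun n : ℕ => 2 * n - 1) atTop atTop :=
      tendsto_atTop_mono (fun n => by simp only [id]; omega) tendsto_id
    simpa using ((FloorSemiring.tendsto_pow_div_factorial_atTop (Real.pi / (r : ℝ))).comp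
      h1).const_mul (Real.pi / r)
  have hsmall := hlim.eventually (gt_mem_nhds (show 0 < c / 2 / (C + 1) by positivity))
  obtain ⟨n, h1, h2, h3⟩ := (hlow.and (hsmall.and (eventually_ge_atTop 1))).exists
  have hf : (0 : ℝ) < ((2 * n - 1)! : ℝ) := by exact_mod_cast Nat.factorial_pos _
  have hbn := hb (2 * n)
  rw [FormalMultilinearSeries.ofScalars_norm] at hbn
  rw [← mul_div_assoc, mul_pow_sub_one (show 2 * n ≠ 0 by omega), div_pow, div_lt_div_iff₀ hf
    (by positivity)] at h2
  have h4 : c / 2 * ((2 * n - 1)! : ℝ) / Real.pi ^ (2 * n) * (r : ℝ) ^ (2 * n) ≤ C :=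
    (mul_le_mul_of_nonneg_right h1 (by positivity)).trans hbn
  have hrp : (0 : ℝ) < (r : ℝ) ^ (2 * n) := by positivity
  have hpp : (0 : ℝ) < Real.pi ^ (2 * n) := by positivity
  rw [div_mul_eq_mul_div, div_le_iff₀ hpp] at h4
  rw [div_mul_eq_mul_div, div_lt_iff₀ hrp] at h2
  nlinarith

end McCoyWu

theorem theorem1p6 (η : ℝ) (hη : 0 < η) :
    (∀ α : ℝ, IntegrableOn (McCoyWu.integrand α) (Ioo (0 : ℝ) η)) ∧
    AnalyticOnNhd ℝ (McCoyWu.F η) (Ioo (-1 : ℝ) 1 \ {0}) ∧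
    ContDiffOn ℝ ∞ (McCoyWu.F η) (Ioo (-1 : ℝ) 1) ∧
    ¬ AnalyticAt ℝ (McCoyWu.F η) 0 ∧
    McCoyWu.taylorCoeff (McCoyWu.F η) 1 = -η ∧
    (∀ n : ℕ, 1 ≤ n → McCoyWu.taylorCoeff (McCoyWu.F η) (2 * n + 1) = 0) ∧
    (fun n : ℕ => McCoyWu.taylorCoeff (McCoyWu.F η) (2 * n)) ~[atTop]
      (fun n : ℕ => 4 * Real.exp (-Real.eulerMascheroniConstant) * (-1 : ℝ) ^ (n + 1) *
        ((2 * n - 1)! : ℝ) / Real.pi ^ (2 * n)) ∧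
    (FormalMultilinearSeries.ofScalars ℝ (McCoyWu.taylorCoeff (McCoyWu.F η))).radius = 0 := by
  refine ⟨McCoyWu.integrableOn_integrand η, fun α hα => McCoyWu.analyticAt_F hη hα.2,
    fun α _ => (McCoyWu.contDiffAt_F hη α).contDiffWithinAt, fun h => ?_, ?_, fun n hn => ?_,
    McCoyWu.taylorCoeff_even_isEquivalent hη, McCoyWu.radius_taylorSeries_eq_zero hη⟩
  · exact h.hasFPowerSeriesAt.radius_pos.ne' (McCoyWu.radius_taylorSeries_eq_zero hη)
  · rw [McCoyWu.taylorCoeff, McCoyWu.iteratedDeriv_F hη,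
      McCoyWu.iteratedDeriv_evenF_odd hη odd_one]
    simp
  · rw [McCoyWu.taylorCoeff, McCoyWu.iteratedDeriv_F hη,
      McCoyWu.iteratedDeriv_evenF_odd hη (odd_two_mul_add_one n), if_neg (by omega)]
    simp
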